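/- **Step-stress plan.** Let $k\ge 2$, let $x_1<\dots<x_k$ be stress levels, and let $0=t_0<t_1<\dots<t_L$ be inspection times, among which are $\tau_i=t_{l_i}$ with $1\le l_1<\dots<l_k=L$; put $\tau_0=0$. The stress is raised from $x_i$ to $x_{i+1}$ at time $\tau_i$ $(1\le i<k)$, and the test ends at $\tau_k$. **Model.** Let $\Theta=(0,\infty)\times\mathbb{R}$. For $\theta=(\theta_0,\theta_1)\in\Theta$ let $\lambda_i=\lambda_i(\theta)=\theta_0e^{\theta_1x_i}$ and, for $1\le i\le k$, $a_{i-1}=\lambda_i^{-1}\sum_{l=1}^{i-1}(\tau_l-\tau_{l-1})\lambda_l$ and $a^*_{i-1}=\lambda_i^{-1}\sum_{l=1}^{i-1}\lambda_l(\tau_l-\tau_{l-1})(x_l-x_i)$. The lifetime distribution function (cumulative exposure model) and its density are, for $s>0$, $$G_T(s)=1-e^{-\lambda_i(s+a_{i-1}-\tau_{i-1})},\qquad g_T(s)=\lambda_ie^{-\lambda_i(s+a_{i-1}-\tau_{i-1})},$$ where $i=1$ if $s<\tau_1$, $i$ is such that $\tau_{i-1}\le s<\tau_i$ if $\tau_1\le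 s<\tau_{k-1}$, and $i=k$ if $s\ge\tau_{k-1}$; moreover $G_T(s)=0$ for $s\le 0$. Put $\pi_j(\theta)=G_T(t_j)-G_T(t_{j-1})$ for $1\le j\le L$, $\pi_{L+1}(\theta)=1-G_T(t_L)$, and $\pi(\theta)=(\pi_1(\theta),\dots,\pi_{L+1}(\theta))^T$. **Estimator.** Let $\theta^*\in\Theta$ be the true parameter value and let $T_1,T_2,\dots$ be independent lifetimes with distribution function $G_T$ at $\theta=\theta^*$. Let $\widehat p=\widehat p_N$ be the vector of relative frequencies among $T_1,\dots,T_N$ of the cells $(t_{j-1},t_j]$ $(1\le j\le L)$ and $(t_L,\infty)$. Let $\beta\ge0$ and $$d_\beta(p,q)=\sum_{j=1}^{L+1}\Big(q_j^{1+\beta}-\big(1+\tfrac1\beta\big)p_jq_j^\beta+\tfrac1\beta p_j^{\beta+1}\Big)\ \ (\beta>0),\qquad d_0(p,q)=\sum_{j=1}^{L+1}p_j\log\frac{p_j}{q_j}\ \ (0\log 0=0).$$ Let $\widehat\theta=\widehat\theta_N$ be a minimum density power divergence estimator (MDPDE), that is, a random vector which almost surely minimizes $\theta\mapsto d_\beta(\widehat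 p,\pi(\theta))$ over $\Theta$ whenever a minimizer exists (and is arbitrary otherwise). For $\beta=0$ this is the maximum likelihood estimator. **Matrices.** Let $W=W(\theta)$ be the $(L+1)\times2$ matrix with rows $z_j-z_{j-1}$ $(1\le j\le L+1)$, where $z_0=z_{L+1}=0$ and, for $1\le j\le L$, $$z_j=g_T(t_j)\begin{pmatrix}(t_j+a_{i-1}-\tau_{i-1})/\theta_0\\ (t_j+a_{i-1}-\tau_{i-1})x_i+a^*_{i-1}\end{pmatrix},$$ $i$ being the stress level that enters $G_T(t_j)$ and $g_T(t_j)$ above. With $D_\pi=\operatorname{diag}(\pi_1(\theta),\dots,\pi_{L+1}(\theta))$ and $\pi^\beta=(\pi_1(\theta)^\beta,\dots,\pi_{L+1}(\theta)^\beta)^T$ let $$J_\beta(\theta)=W^TD_\pi^{\beta-1}W,\qquad K_\beta(\theta)=W^T\big(D_\pi^{2\beta-1}-\pi^\beta(\pi^\beta)^T\big)W .$$ **Theorem.** Let $x_0\in\mathbb{R}$ be the stress level at normal operating conditions and $t\ge0$ a mission time. The reliability under $x_0$ is $R_0(t)=h(\theta)=\exp(-\theta_0e^{\theta_1x_0}t)$.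 Its gradient at every $\theta\in\Theta$ is $$\nabla h(\theta)=\Big(-R_0(t)\frac{\lambda_0t}{\theta_0},\ -R_0(t)\lambda_0t\,x_0\Big)^T,\qquad \lambda_0=\theta_0e^{\theta_1x_0}.$$ The matrix $J_\beta(\theta^*)$ is invertible, the number $$\sigma^2=\nabla h(\theta^*)^TJ_\beta^{-1}(\theta^*)K_\beta(\theta^*)J_\beta^{-1}(\theta^*)\nabla h(\theta^*)$$ is nonnegative, and the estimated reliability $\widehat R_0(t)=h(\widehat\theta_N)$ satisfies $$\sqrt N\,\big(h(\widehat\theta_N)-h(\theta^*)\big)\longrightarrow\mathcal N(0,\sigma^2)\quad\text{in distribution as }N\to\infty .$$ -/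

import Mathlib

open MeasureTheory ProbabilityTheory Filter
open scoped Matrix

noncomputable section

/-- A step-stress accelerated life-testing plan. Stress levels `x 1 < ⋯ < x k`; the stress is raised
from `x i` to `x (i + 1)` at time `τ i` (`1 ≤ i < k`) and the test ends at `τ k`; inspection times
`0 = insp 0 < insp 1 < ⋯ < insp L`, the times `τ i = insp (l i)` being among them and `l k = L`.
The values of `x`, `τ`, `l`, `insp` at indices outside these ranges are irrelevant. -/
structure StepStressPlan where
  /-- number of stress levels -/
  k : ℕ
  /-- number of inspection times -/
  L : ℕ
  /-- stress levels -/
  x : ℕ → ℝ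
  /-- times of stress change; `τ k` is the end of the test -/
  τ : ℕ → ℝ
  /-- inspection times -/
  insp : ℕ → ℝ
  /-- `l i` is the number of inspection times up to `τ i` -/
  l : ℕ → ℕ
  one_le_k : 1 ≤ k
  x_lt : ∀ i, 1 ≤ i → i < k → x i < x (i + 1)
  τ_zero : τ 0 = 0
  insp_zero : insp 0 = 0
  insp_lt : ∀ j, j < L → insp j < insp (j + 1)
  l_one_pos : 1 ≤ l 1
  l_lt : ∀ i, 1 ≤ i → i < k → l i < l (i + 1)
  l_k : l k = L
  τ_eq : ∀ i, 1 ≤ i → i ≤ k → τ i = insp (l i)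

namespace StepStressPlan

/-- The parameter space `Θ = ℝ⁺ × ℝ`, with `θ = (θ 0, θ 1)`. -/
def paramSpace : Set (Fin 2 → ℝ) := {θ | 0 < θ 0}

/-- Failure rate `θ₀ exp (θ₁ s)` under constant stress `s`. -/
def rate (θ : Fin 2 → ℝ) (s : ℝ) : ℝ := θ 0 * Real.exp (θ 1 * s)

variable (d : StepStressPlan)

/-- Failure rate `λ_i` at the `i`-th stress level. -/
def lam (θ : Fin 2 → ℝ) (i : ℕ) : ℝ := rate θ (d.x i)

/-- The equivalent age `a_m = (∑_{r=1}^{m} (τ_r - τ_{r-1}) λ_r) / λ_{m+1}` under level `m + 1` at the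
time `τ_m` at which that level starts; `a_0 = 0`. -/
def a (θ : Fin 2 → ℝ) (m : ℕ) : ℝ :=
  (∑ r ∈ Finset.range m, (d.τ (r + 1) - d.τ r) * d.lam θ (r + 1)) / d.lam θ (m + 1)

/-- `a*_m = (∑_{r=1}^{m} λ_r (τ_r - τ_{r-1}) (-x_{m+1} + x_r)) / λ_{m+1}`. -/
def aStar (θ : Fin 2 → ℝ) (m : ℕ) : ℝ :=
  1 / d.lam θ (m + 1) * ∑ r ∈ Finset.range m,
    d.lam θ (r + 1) * (d.τ (r + 1) - d.τ r) * (-d.x (m + 1) + d.x (r + 1))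

/-- Number of stress changes up to and including time `s`: it is `m` iff `τ m ≤ s < τ (m + 1)` (and
`k - 1` from `τ (k - 1)` on), so that the stress level in force at time `s` is `m + 1`. -/
def stage (s : ℝ) : ℕ := ((Finset.Ico 1 d.k).filter fun i => d.τ i ≤ s).card

/-- Equivalent time `s + a_m - τ_m` under the level `m + 1` in force at time `s`. -/
def eqTime (θ : Fin 2 → ℝ) (s : ℝ) : ℝ := s + d.a θ (d.stage s) - d.τ (d.stage s)

/-- Lifetime distribution function `G_T` of the cumulative exposure model. -/
def cdfT (θ : Fin 2 → ℝ) (s : ℝ) : ℝ :=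
  if 0 < s then 1 - Real.exp (-(d.lam θ (d.stage s + 1) * d.eqTime θ s)) else 0

/-- Lifetime density `g_T` of the cumulative exposure model. -/
def pdfT (θ : Fin 2 → ℝ) (s : ℝ) : ℝ :=
  if 0 < s then
    d.lam θ (d.stage s + 1) * Real.exp (-(d.lam θ (d.stage s + 1) * d.eqTime θ s))
  else 0

/-- The `L + 1` observation cells. With `j = 0, …, L - 1` the cell of index `j` is
`(insp j, insp (j + 1)]`; the last one is survival beyond `insp L`. -/
def cell (j : Fin (d.L + 1)) : Set ℝ :=
  if (j : ℕ) < d.L then Set.Ioc (d.insp j) (d.insp (j + 1)) else Set.Ioi (d.insp d.L)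

/-- Theoretical cell probabilities `π(θ)`. -/
def cellProb (θ : Fin 2 → ℝ) (j : Fin (d.L + 1)) : ℝ :=
  if (j : ℕ) < d.L then d.cdfT θ (d.insp (j + 1)) - d.cdfT θ (d.insp j)
  else 1 - d.cdfT θ (d.insp d.L)

open Classical in
/-- Number of the first `N` devices, with lifetimes `T 0, …, T (N - 1)`, falling in the cell `j`. -/
def count (T : ℕ → ℝ) (N : ℕ) (j : Fin (d.L + 1)) : ℕ :=
  ((Finset.range N).filter fun m => T m ∈ d.cell j).card

/-- Empirical probability vector of the first `N` devices. -/
def empirical (T : ℕ → ℝ) (N : ℕ) (j : Fin (d.L + 1)) : ℝ := (d.count T N j : ℝ) / N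

/-- Density power divergence of tuning parameter `β` between two probability vectors, the
Kullback-Leibler divergence at `β = 0`. -/
def dpd {n : ℕ} (β : ℝ) (p q : Fin n → ℝ) : ℝ :=
  if β = 0 then ∑ j, p j * Real.log (p j / q j)
  else ∑ j, (q j ^ (1 + β) - (1 + 1 / β) * (p j * q j ^ β) + 1 / β * p j ^ (β + 1))

/-- `θ` minimizes over the parameter space the divergence between `p` and the model: `θ` is a minimum
density power divergence estimate based on the empirical vector `p`. -/
def IsMDPDE (β : ℝ) (p : Fin (d.L + 1) → ℝ) (θ : Fin 2 → ℝ) : Prop :=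
  θ ∈ paramSpace ∧ IsMinOn (fun θ' => dpd β p (d.cellProb θ')) paramSpace θ

/-- The vectors `z_j`, with `z_0 = z_{L+1} = 0`. The level `i` is the one in force right after the
`j`-th inspection (`i - 1` is the stage of `insp j`). -/
def z (θ : Fin 2 → ℝ) (j : ℕ) : Fin 2 → ℝ :=
  if 1 ≤ j ∧ j ≤ d.L then
    d.pdfT θ (d.insp j) • ![d.eqTime θ (d.insp j) / θ 0,
      d.eqTime θ (d.insp j) * d.x (d.stage (d.insp j) + 1) + d.aStar θ (d.stage (d.insp j))]
  else 0

/-- The `(L + 1) × 2` matrix with rows `z_j - z_{j-1}`, `j = 1, …, L + 1`. -/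
def W (θ : Fin 2 → ℝ) : Matrix (Fin (d.L + 1)) (Fin 2) ℝ :=
  Matrix.of fun j => d.z θ (j + 1) - d.z θ j

/-- `J_β(θ) = Wᵀ D_π^{β-1} W`. -/
def J (β : ℝ) (θ : Fin 2 → ℝ) : Matrix (Fin 2) (Fin 2) ℝ :=
  (d.W θ)ᵀ * Matrix.diagonal (fun j => d.cellProb θ j ^ (β - 1)) * d.W θ

/-- `K_β(θ) = Wᵀ (D_π^{2β-1} - π^β (π^β)ᵀ) W`. -/
def K (β : ℝ) (θ : Fin 2 → ℝ) : Matrix (Fin 2) (Fin 2) ℝ :=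
  (d.W θ)ᵀ * (Matrix.diagonal (fun j => d.cellProb θ j ^ (2 * β - 1)) -
    Matrix.vecMulVec (fun j => d.cellProb θ j ^ β) (fun j => d.cellProb θ j ^ β)) * d.W θ

/-- Reliability `h(θ) = R₀(t) = exp (-θ₀ exp (θ₁ x₀) t)` at mission time `t` under constant
stress `x₀`. -/
def reliability (x₀ t : ℝ) (θ : Fin 2 → ℝ) : ℝ :=
  Real.exp (-(θ 0 * Real.exp (θ 1 * x₀) * t))

/-- The explicit vector `(-R₀(t) λ₀ t / θ₀, -R₀(t) λ₀ t x₀)`, where `λ₀ = θ₀ exp (θ₁ x₀)`. -/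
def reliabilityGrad (x₀ t : ℝ) (θ : Fin 2 → ℝ) : Fin 2 → ℝ :=
  ![-(reliability x₀ t θ * (rate θ x₀ * t / θ 0)), -(reliability x₀ t θ * (rate θ x₀ * t * x₀))]

/-- `∇h(θ)ᵀ J_β(θ)⁻¹ K_β(θ) J_β(θ)⁻¹ ∇h(θ)`. -/
def reliabilityVar (β x₀ t : ℝ) (θ : Fin 2 → ℝ) : ℝ :=
  reliabilityGrad x₀ t θ ⬝ᵥ
    (((d.J β θ)⁻¹ * d.K β θ * (d.J β θ)⁻¹) *ᵥ reliabilityGrad x₀ t θ)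

end StepStressPlan

end

noncomputable section

open scoped Topology

/-! The estimator depends on the sample only through the frequency vector `p`, so the proof splits
into a deterministic study of minimizers for `p` near the true cell probabilities and a limit
theorem for linear functionals of `p`.

Deterministic half. The cumulative hazard is piecewise linear in time, with the rates as slopes. The
cell probabilities determine it at the times of stress change, hence all rates; two distinct stress
levels then give the parameter, continuously (`comap_cellProb_le_nhds`). The same argument on
derivatives shows that `W` is injective, so `J` is positive definite. Each summand of the divergence
decreases in `q` up to `p` and increases afterwards. A parameter that does no worse than the true
one therefore has nearby cell probabilities, and is itself nearby; this gives existence and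
consistency (`eventually_isMDPDE`). Linearizing the score equation expresses a smooth function of
the minimizer as a linear functional of `p`, up to a remainder small relative to the deviation of
`p` (`eventually_isMDPDE_expansion`).

Probabilistic half. A linear functional of the frequencies is a sample mean of a step function of
the lifetimes, so the scalar central limit theorem applies (`tendstoInDistribution_empirical`). Its
variance is the sandwich expression (`reliabilityVar_eq`). Chebyshev's inequality keeps the rescaled
deviation bounded in probability, so the remainder is negligible (`tendstoInMeasure_est`), and
Slutsky's lemma concludes. -/

/-- The linear functional `v ↦ u ⬝ᵥ v`. -/
def dotCLM {n : ℕ} (u : Fin n → ℝ) : (Fin n → ℝ) →L[ℝ] ℝ :=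
  LinearMap.toContinuousLinearMap (dotProductBilin ℝ ℝ u)

@[simp]
theorem dotCLM_apply {n : ℕ} (u v : Fin n → ℝ) : dotCLM u v = u ⬝ᵥ v := rfl

/-! ### Rates, stages and the cumulative hazard. -/

namespace StepStressPlan

theorem isOpen_paramSpace : IsOpen paramSpace :=
  isOpen_lt continuous_const (continuous_apply 0)

theorem rate_pos {θ : Fin 2 → ℝ} (hθ : θ ∈ paramSpace) (s : ℝ) : 0 < rate θ s :=
  mul_pos hθ (Real.exp_pos _)

theorem continuous_rate (s : ℝ) : Continuous fun θ => rate θ s := by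
  unfold rate; fun_prop

theorem hasFDerivAt_rate {θ : Fin 2 → ℝ} (hθ : θ ∈ paramSpace) (s : ℝ) :
    HasFDerivAt (fun θ => rate θ s) (dotCLM (rate θ s • ![1 / θ 0, s])) θ := by
  have h0 : HasFDerivAt (fun θ : Fin 2 → ℝ => θ 0)
    (ContinuousLinearMap.proj (R := ℝ) (φ := fun _ : Fin 2 => ℝ) 0) θ := hasFDerivAt_apply 0 θ
  have h1 : HasFDerivAt (fun θ : Fin 2 → ℝ => θ 1)
    (ContinuousLinearMap.proj (R := ℝ) (φ := fun _ : Fin 2 => ℝ) 1) θ := hasFDerivAt_apply 1 θ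
  have hne : θ 0 ≠ 0 := (show 0 < θ 0 from hθ).ne'
  unfold rate
  convert! h0.mul ((h1.mul_const s).exp) using 1
  ext v
  simp [dotProduct, Fin.sum_univ_two]
  field_simp
  ring

variable (d : StepStressPlan)

theorem lam_pos {θ : Fin 2 → ℝ} (hθ : θ ∈ paramSpace) (i : ℕ) : 0 < d.lam θ i :=
  rate_pos hθ _

/-- Cumulative hazard `∑_{r ≤ m} (τ_r - τ_{r-1}) λ_r` at the time `τ_m`. -/
def stageHazard (θ : Fin 2 → ℝ) (m : ℕ) : ℝ :=
  ∑ r ∈ Finset.range m, (d.τ (r + 1) - d.τ r) * d.lam θ (r + 1)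

/-- Cumulative hazard at the time `s`. -/
def hazard (θ : Fin 2 → ℝ) (s : ℝ) : ℝ :=
  d.lam θ (d.stage s + 1) * (s - d.τ (d.stage s)) + d.stageHazard θ (d.stage s)

/-- Multiplying by the rate clears the division in `a`: the exponent becomes a combination of rates
whose coefficients do not involve `θ`. -/
theorem lam_mul_eqTime {θ : Fin 2 → ℝ} (hθ : θ ∈ paramSpace) (s : ℝ) :
    d.lam θ (d.stage s + 1) * d.eqTime θ s = d.hazard θ s := by
  have := (d.lam_pos hθ (d.stage s + 1)).ne'
  unfold eqTime hazard a stageHazard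
  field_simp
  ring

theorem insp_strictMono {i j : ℕ} (hij : i < j) (hj : j ≤ d.L) : d.insp i < d.insp j := by
  induction j, hij using Nat.le_induction with
  | base => exact d.insp_lt i hj
  | succ j h ih => exact (ih (by omega)).trans (d.insp_lt j hj)

theorem insp_pos {j : ℕ} (h0 : 0 < j) (hj : j ≤ d.L) : 0 < d.insp j := by
  simpa [d.insp_zero] using d.insp_strictMono h0 hj

theorem l_strictMono {i j : ℕ} (hi : 1 ≤ i) (hij : i < j) (hj : j ≤ d.k) : d.l i < d.l j := by
  induction j, hij using Nat.le_induction with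
  | base => exact d.l_lt i hi hj
  | succ j h ih => exact (ih (by omega)).trans (d.l_lt j (by omega) hj)

theorem l_pos {i : ℕ} (hi : 1 ≤ i) (hik : i ≤ d.k) : 0 < d.l i := by
  rcases hi.eq_or_lt with rfl | h
  · exact d.l_one_pos
  · exact (Nat.zero_le _).trans_lt (d.l_strictMono le_rfl h hik)

theorem l_le {i : ℕ} (hi : 1 ≤ i) (hik : i ≤ d.k) : d.l i ≤ d.L := by
  rcases hik.eq_or_lt with rfl | h
  · exact d.l_k.le
  · exact (d.l_strictMono hi h le_rfl).le.trans d.l_k.le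

theorem τ_strictMono {i j : ℕ} (hij : i < j) (hj : j ≤ d.k) : d.τ i < d.τ j := by
  rw [d.τ_eq j (by omega) hj]
  rcases Nat.eq_zero_or_pos i with rfl | hi
  · rw [d.τ_zero]
    exact d.insp_pos (d.l_pos (by omega) hj) (d.l_le (by omega) hj)
  · rw [d.τ_eq i hi (by omega)]
    exact d.insp_strictMono (d.l_strictMono hi hij hj) (d.l_le (by omega) hj)

theorem τ_mono {i j : ℕ} (hij : i ≤ j) (hj : j ≤ d.k) : d.τ i ≤ d.τ j := by
  rcases hij.eq_or_lt with rfl | h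
  · exact le_rfl
  · exact (d.τ_strictMono h hj).le

/-- The upper bound is required only below the last stage, since that stage never ends. -/
theorem stage_eq {m : ℕ} {s : ℝ} (hm : m < d.k) (h1 : d.τ m ≤ s)
    (h2 : m + 1 < d.k → s < d.τ (m + 1)) : d.stage s = m := by
  have : (Finset.Ico 1 d.k).filter (fun i => d.τ i ≤ s) = Finset.Ico 1 (m + 1) := by
    ext i
    simp only [Finset.mem_filter, Finset.mem_Ico]
    refine ⟨fun ⟨⟨hi1, hik⟩, hi⟩ => ⟨hi1, ?_⟩, fun ⟨hi1, him⟩ => ⟨⟨hi1, by omega⟩, ?_⟩⟩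
    · by_contra! hcon
      exact absurd ((d.τ_mono hcon hik.le).trans hi) (not_le.2 (h2 (by omega)))
    · exact (d.τ_mono (by omega) hm.le).trans h1
  rw [stage, this]
  simp

theorem exists_stage {s : ℝ} (hs : 0 ≤ s) :
    ∃ m < d.k, d.τ m ≤ s ∧ (m + 1 < d.k → s < d.τ (m + 1)) := by
  have h0 : d.τ 0 ≤ s := by rwa [d.τ_zero]
  have hk := d.one_le_k
  classical
  refine ⟨Nat.findGreatest (fun m => d.τ m ≤ s) (d.k - 1), ?_, ?_, fun h => ?_⟩
  · exact (Nat.findGreatest_le _).trans_lt (by omega)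
  · exact Nat.findGreatest_spec (P := fun m => d.τ m ≤ s) (Nat.zero_le _) h0
  · exact not_le.1 (Nat.findGreatest_is_greatest (P := fun m => d.τ m ≤ s)
      (Nat.lt_succ_self _) (by omega))

theorem stage_spec {s : ℝ} (hs : 0 ≤ s) :
    d.stage s < d.k ∧ d.τ (d.stage s) ≤ s ∧ (d.stage s + 1 < d.k → s < d.τ (d.stage s + 1)) := by
  obtain ⟨m, hm, h1, h2⟩ := d.exists_stage hs
  rw [d.stage_eq hm h1 h2]
  exact ⟨hm, h1, h2⟩

theorem stageHazard_succ (θ : Fin 2 → ℝ) (m : ℕ) :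
    d.stageHazard θ (m + 1) = d.stageHazard θ m + (d.τ (m + 1) - d.τ m) * d.lam θ (m + 1) :=
  Finset.sum_range_succ _ _

theorem stageHazard_mono {θ : Fin 2 → ℝ} (hθ : θ ∈ paramSpace) {m m' : ℕ} (h : m ≤ m')
    (hm : m' ≤ d.k) : d.stageHazard θ m ≤ d.stageHazard θ m' := by
  induction m', h using Nat.le_induction with
  | base => exact le_rfl
  | succ j h ih =>
    rw [stageHazard_succ]
    have := mul_pos (sub_pos.2 (d.τ_strictMono (Nat.lt_succ_self j) hm)) (d.lam_pos hθ (j + 1))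
    linarith [ih (by omega)]

/-- At `τ k` the stage is still `k - 1`, but the hazard is continuous in time, so the formula of the
earlier change points persists. -/
theorem hazard_τ {i : ℕ} (hi : i ≤ d.k) (θ : Fin 2 → ℝ) :
    d.hazard θ (d.τ i) = d.stageHazard θ i := by
  have hk := d.one_le_k
  rcases hi.eq_or_lt with rfl | h
  · have hs : d.stage (d.τ d.k) = d.k - 1 :=
      d.stage_eq (by omega) (d.τ_mono (by omega) le_rfl) (by omega)
    rw [hazard, hs]
    have := d.stageHazard_succ θ (d.k - 1)
    rw [Nat.sub_add_cancel hk] at this ⊢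
    rw [this]
    ring
  · have hs : d.stage (d.τ i) = i :=
      d.stage_eq h le_rfl fun h => d.τ_strictMono (Nat.lt_succ_self i) h.le
    rw [hazard, hs]
    ring

theorem hazard_strictMono {θ : Fin 2 → ℝ} (hθ : θ ∈ paramSpace) {s s' : ℝ} (hs : 0 ≤ s)
    (h : s < s') : d.hazard θ s < d.hazard θ s' := by
  obtain ⟨hm, h1, h2⟩ := d.stage_spec hs
  obtain ⟨hm', h1', h2'⟩ := d.stage_spec (hs.trans h.le)
  have hle : d.stage s ≤ d.stage s' :=
    Finset.card_le_card fun i => by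
      simp only [Finset.mem_filter]
      exact fun ⟨hi, his⟩ => ⟨hi, his.trans h.le⟩
  unfold hazard
  rcases hle.eq_or_lt with heq | hlt
  · rw [← heq]
    have := mul_lt_mul_of_pos_left (sub_lt_sub_right h (d.τ (d.stage s)))
      (d.lam_pos hθ (d.stage s + 1))
    linarith
  -- Different stages: the hazard rises strictly up to the end of the stage of `s`, and does not
  -- decrease from there to `s'`.
  · have e1 := mul_lt_mul_of_pos_left (sub_lt_sub_right (h2 (by omega)) (d.τ (d.stage s)))
      (d.lam_pos hθ (d.stage s + 1))
    have e2 := d.stageHazard_mono hθ (Nat.succ_le_of_lt hlt) hm'.le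
    rw [Nat.succ_eq_add_one, stageHazard_succ] at e2
    have e3 := mul_nonneg (d.lam_pos hθ (d.stage s' + 1)).le (sub_nonneg.2 h1')
    linarith

theorem hazard_zero (θ : Fin 2 → ℝ) : d.hazard θ 0 = 0 := by
  have := d.hazard_τ (Nat.zero_le _) θ
  rw [d.τ_zero] at this
  simp [this, stageHazard]

theorem cdfT_eq {θ : Fin 2 → ℝ} (hθ : θ ∈ paramSpace) {s : ℝ} (hs : 0 ≤ s) :
    d.cdfT θ s = 1 - Real.exp (-d.hazard θ s) := by
  rcases hs.eq_or_lt with rfl | h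
  · simp [cdfT, hazard_zero]
  · rw [cdfT, if_pos h, lam_mul_eqTime _ hθ]

theorem insp_nonneg {j : ℕ} (hj : j ≤ d.L) : 0 ≤ d.insp j := by
  rcases Nat.eq_zero_or_pos j with rfl | h
  · exact d.insp_zero.ge
  · exact (d.insp_pos h hj).le

theorem cellProb_pos {θ : Fin 2 → ℝ} (hθ : θ ∈ paramSpace) (j : Fin (d.L + 1)) :
    0 < d.cellProb θ j := by
  unfold cellProb
  split_ifs with h
  · rw [d.cdfT_eq hθ (d.insp_nonneg h), d.cdfT_eq hθ (d.insp_nonneg h.le)]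
    have := d.hazard_strictMono hθ (d.insp_nonneg h.le) (d.insp_lt j h)
    have := Real.exp_lt_exp.2 (neg_lt_neg this)
    linarith
  · rw [d.cdfT_eq hθ (d.insp_nonneg le_rfl)]
    simp [Real.exp_pos]

/-- Telescoping. The partial sums recover the distribution function at the inspection times, which
is how the model is inverted. -/
theorem sum_cellProb_lt {θ : Fin 2 → ℝ} (m : ℕ) (hm : m ≤ d.L) :
    ∑ j : Fin (d.L + 1), (if (j : ℕ) < m then d.cellProb θ j else 0) = d.cdfT θ (d.insp m) := by
  have h1 : ∀ j : Fin (d.L + 1), (if (j : ℕ) < m then d.cellProb θ j else 0) =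
      (fun i : ℕ => if i < m then d.cdfT θ (d.insp (i + 1)) - d.cdfT θ (d.insp i) else 0) j := by
    intro j
    by_cases h : (j : ℕ) < m
    · simp [h, cellProb, h.trans_le hm]
    · simp [h]
  rw [Finset.sum_congr rfl fun j _ => h1 j,
    Fin.sum_univ_eq_sum_range (fun i : ℕ =>
      if i < m then d.cdfT θ (d.insp (i + 1)) - d.cdfT θ (d.insp i) else 0), ← Finset.sum_filter,
    show (Finset.range (d.L + 1)).filter (· < m) = Finset.range m by
      ext i; simp only [Finset.mem_filter, Finset.mem_range]; omega,
    Finset.sum_range_sub (fun i => d.cdfT θ (d.insp i)), d.insp_zero]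
  simp [cdfT]

theorem sum_cellProb (θ : Fin 2 → ℝ) : ∑ j, d.cellProb θ j = 1 := by
  have h := d.sum_cellProb_lt (θ := θ) d.L le_rfl
  rw [Fin.sum_univ_castSucc] at h ⊢
  simp only [Fin.val_castSucc, Fin.is_lt, if_true, Fin.val_last, lt_irrefl, if_false,
    add_zero] at h
  rw [h]
  simp [cellProb]

/-! ### Gradients of the hazard and of the cell probabilities. -/

/-- Gradient of the cumulative hazard. -/
def hazardGrad (θ : Fin 2 → ℝ) (s : ℝ) : Fin 2 → ℝ :=
  d.lam θ (d.stage s + 1) •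
    ![d.eqTime θ s / θ 0, d.eqTime θ s * d.x (d.stage s + 1) + d.aStar θ (d.stage s)]

/-- The right side is the termwise gradient of a combination of rates, each rate `λ` having gradient
`λ (1 / θ 0, x)`. The shift by the current stress level in `aStar` cancels against `eqTime` times
that level. -/
theorem hazardGrad_eq {θ : Fin 2 → ℝ} (hθ : θ ∈ paramSpace) (s : ℝ) :
    d.hazardGrad θ s =
      ((s - d.τ (d.stage s)) * d.lam θ (d.stage s + 1)) • ![1 / θ 0, d.x (d.stage s + 1)] +
      ∑ r ∈ Finset.range (d.stage s),
        ((d.τ (r + 1) - d.τ r) * d.lam θ (r + 1)) • ![1 / θ 0, d.x (r + 1)] := by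
  have hl := (d.lam_pos hθ (d.stage s + 1)).ne'
  have he := d.lam_mul_eqTime hθ s
  unfold hazardGrad
  ext i
  fin_cases i
  · simp only [Fin.zero_eta, Pi.smul_apply, Matrix.cons_val_zero, smul_eq_mul, Pi.add_apply,
      Finset.sum_apply, ← Finset.sum_mul]
    rw [← mul_div_assoc, he, hazard, stageHazard]
    ring
  · simp only [Fin.mk_one, Pi.smul_apply, Matrix.cons_val_one, smul_eq_mul, Pi.add_apply,
      Finset.sum_apply, aStar, Matrix.cons_val_fin_one]
    rw [mul_add, ← mul_assoc, he, ← mul_assoc, mul_one_div_cancel hl, one_mul, hazard,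
      stageHazard, add_mul, add_assoc, Finset.sum_mul, ← Finset.sum_add_distrib]
    congr 1
    · ring
    · exact Finset.sum_congr rfl fun r _ => by ring

theorem hasFDerivAt_hazard {θ : Fin 2 → ℝ} (hθ : θ ∈ paramSpace) (s : ℝ) :
    HasFDerivAt (fun θ => d.hazard θ s) (dotCLM (d.hazardGrad θ s)) θ := by
  rw [d.hazardGrad_eq hθ]
  unfold hazard stageHazard
  have h := ((hasFDerivAt_rate hθ (d.x (d.stage s + 1))).mul_const (s - d.τ (d.stage s))).add
    (HasFDerivAt.fun_sum (u := Finset.range (d.stage s)) fun r _ =>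
      (hasFDerivAt_rate hθ (d.x (r + 1))).const_mul (d.τ (r + 1) - d.τ r))
  convert! h using 1
  ext v
  simp only [dotCLM_apply, add_dotProduct, smul_dotProduct, sum_dotProduct, smul_eq_mul,
    _root_.add_apply, _root_.smul_apply, _root_.sum_apply, mul_assoc]
  rfl

theorem z_eq {θ : Fin 2 → ℝ} (hθ : θ ∈ paramSpace) {j : ℕ} (hj : 1 ≤ j) (hjL : j ≤ d.L) :
    d.z θ j = Real.exp (-d.hazard θ (d.insp j)) • d.hazardGrad θ (d.insp j) := by
  rw [z, if_pos ⟨hj, hjL⟩, pdfT, if_pos (d.insp_pos hj hjL), hazardGrad, smul_smul,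
    lam_mul_eqTime _ hθ, mul_comm]

theorem z_zero (θ : Fin 2 → ℝ) : d.z θ 0 = 0 := by simp [z]

theorem z_last (θ : Fin 2 → ℝ) : d.z θ (d.L + 1) = 0 := by simp [z]

theorem hasFDerivAt_cdfT {θ : Fin 2 → ℝ} (hθ : θ ∈ paramSpace) {j : ℕ} (hjL : j ≤ d.L) :
    HasFDerivAt (fun θ => d.cdfT θ (d.insp j)) (dotCLM (d.z θ j)) θ := by
  rcases Nat.eq_zero_or_pos j with rfl | hj
  · rw [z_zero, d.insp_zero]
    simpa [cdfT, dotCLM] using hasFDerivAt_const (0 : ℝ) θ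
  · have h := ((d.hasFDerivAt_hazard hθ (d.insp j)).neg.exp).const_sub 1
    have he : (fun θ => d.cdfT θ (d.insp j)) =ᶠ[𝓝 θ]
        fun θ => 1 - Real.exp (-d.hazard θ (d.insp j)) := by
      filter_upwards [isOpen_paramSpace.mem_nhds hθ] with θ' hθ'
      exact d.cdfT_eq hθ' (d.insp_nonneg hjL)
    refine HasFDerivAt.congr_of_eventuallyEq ?_ he
    convert! h using 1
    rw [d.z_eq hθ hj hjL]
    ext v
    simp [smul_dotProduct]

theorem hasFDerivAt_cellProb {θ : Fin 2 → ℝ} (hθ : θ ∈ paramSpace) (j : Fin (d.L + 1)) :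
    HasFDerivAt (fun θ => d.cellProb θ j) (dotCLM (d.W θ j)) θ := by
  unfold cellProb
  have hW : d.W θ j = d.z θ (j + 1) - d.z θ j := rfl
  by_cases h : (j : ℕ) < d.L
  · simp only [h, if_true]
    convert! (d.hasFDerivAt_cdfT hθ (Nat.succ_le_of_lt h)).sub (d.hasFDerivAt_cdfT hθ h.le) using 1
    ext v
    simp [hW, sub_dotProduct]
  · have hj : (j : ℕ) = d.L := by omega
    simp only [h, if_false]
    convert! (d.hasFDerivAt_cdfT hθ le_rfl).const_sub 1 using 1
    ext v
    simp [hW, hj, z_last]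

/-- Second derivatives of the model are never needed: in the score, `W` is multiplied by residuals
that vanish at the true pair, so its continuity suffices. -/
theorem continuousAt_z {θ : Fin 2 → ℝ} (hθ : θ ∈ paramSpace) (j : ℕ) :
    ContinuousAt (fun θ => d.z θ j) θ := by
  have hne : θ 0 ≠ 0 := (show 0 < θ 0 from hθ).ne'
  by_cases hj : 1 ≤ j ∧ j ≤ d.L
  · have hl : ∀ i, ContinuousAt (fun θ => d.lam θ i) θ := fun i =>
      (continuous_rate _).continuousAt
    have hl0 : ∀ i, d.lam θ i ≠ 0 := fun i => (d.lam_pos hθ i).ne'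
    have h0 : ContinuousAt (fun θ : Fin 2 → ℝ => θ 0) θ := (continuous_apply 0).continuousAt
    have ha : ∀ m, ContinuousAt (fun θ => d.a θ m) θ := fun m =>
      ContinuousAt.div (tendsto_finsetSum _ fun r _ => (hl _).const_mul _) (hl _) (hl0 _)
    have haS : ∀ m, ContinuousAt (fun θ => d.aStar θ m) θ := fun m =>
      (ContinuousAt.div continuousAt_const (hl _) (hl0 _)).mul
        (tendsto_finsetSum _ fun r _ => ((hl _).mul_const _).mul_const _)
    have hE : ContinuousAt (fun θ => d.eqTime θ (d.insp j)) θ :=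
      ((ha _).const_add _).sub_const _
    simp only [z, hj, pdfT, d.insp_pos hj.1 hj.2, if_true, and_self]
    refine ((hl _).mul ((hl _).mul hE).neg.rexp).smul ?_
    refine continuousAt_pi.2 fun i => ?_
    fin_cases i
    · exact hE.div h0 hne
    · exact (hE.mul_const _).add (haS _)
  · simp only [z, hj, if_false]
    exact continuousAt_const

theorem continuousAt_W {θ : Fin 2 → ℝ} (hθ : θ ∈ paramSpace) (j : Fin (d.L + 1)) :
    ContinuousAt (fun θ => d.W θ j) θ :=
  (d.continuousAt_z hθ _).sub (d.continuousAt_z hθ _)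

/-! ### Identifiability and rank of the Jacobian. -/

/-- The cumulative hazard at the time `τ i` is a function of the cell probabilities. -/
theorem stageHazard_eq_neg_log {θ : Fin 2 → ℝ} (hθ : θ ∈ paramSpace) {i : ℕ} (hi : 1 ≤ i)
    (hik : i ≤ d.k) :
    d.stageHazard θ i = -Real.log (1 - ∑ j : Fin (d.L + 1),
      (if (j : ℕ) < d.l i then d.cellProb θ j else 0)) := by
  rw [d.sum_cellProb_lt _ (d.l_le hi hik), d.cdfT_eq hθ (d.insp_nonneg (d.l_le hi hik)),
    ← d.τ_eq i hi hik, d.hazard_τ hik]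
  simp

/-- The filter describes parameters in `paramSpace` whose cell probabilities approach those of `θ₀`,
with no closeness of the parameters presupposed. -/
theorem tendsto_stageHazard {θ₀ : Fin 2 → ℝ} (hθ₀ : θ₀ ∈ paramSpace) {i : ℕ} (hi : 1 ≤ i)
    (hik : i ≤ d.k) :
    Tendsto (fun θ => d.stageHazard θ i) (comap d.cellProb (𝓝 (d.cellProb θ₀)) ⊓ 𝓟 paramSpace)
      (𝓝 (d.stageHazard θ₀ i)) := by
  have hpos : (1 : ℝ) - ∑ j : Fin (d.L + 1),
      (if (j : ℕ) < d.l i then d.cellProb θ₀ j else 0) ≠ 0 := by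
    rw [d.sum_cellProb_lt _ (d.l_le hi hik), d.cdfT_eq hθ₀ (d.insp_nonneg (d.l_le hi hik))]
    simp
  have hc : ContinuousAt (fun p : Fin (d.L + 1) → ℝ => -Real.log (1 - ∑ j : Fin (d.L + 1),
      (if (j : ℕ) < d.l i then p j else 0))) (d.cellProb θ₀) := by
    refine ContinuousAt.fun_neg (ContinuousAt.log (f := fun p : Fin (d.L + 1) → ℝ =>
      1 - ∑ j : Fin (d.L + 1), (if (j : ℕ) < d.l i then p j else 0)) ?_ hpos)
    refine Continuous.continuousAt (continuous_const.sub (continuous_finsetSum _ fun j _ => ?_))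
    split_ifs
    · exact continuous_apply j
    · exact continuous_const
  rw [d.stageHazard_eq_neg_log hθ₀ hi hik]
  refine Tendsto.congr' ?_ ((hc.tendsto.comp tendsto_comap).mono_left inf_le_left)
  filter_upwards [mem_inf_of_right (mem_principal_self paramSpace)] with θ hθ
  exact (d.stageHazard_eq_neg_log hθ hi hik).symm

theorem tendsto_lam {θ₀ : Fin 2 → ℝ} (hθ₀ : θ₀ ∈ paramSpace) {i : ℕ}
    (hik : i + 1 ≤ d.k) :
    Tendsto (fun θ => d.lam θ (i + 1)) (comap d.cellProb (𝓝 (d.cellProb θ₀)) ⊓ 𝓟 paramSpace)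
      (𝓝 (d.lam θ₀ (i + 1))) := by
  have hτ : d.τ (i + 1) - d.τ i ≠ 0 :=
    (sub_pos.2 (d.τ_strictMono (Nat.lt_succ_self i) hik)).ne'
  have key : ∀ θ, d.lam θ (i + 1) =
      (d.stageHazard θ (i + 1) - d.stageHazard θ i) / (d.τ (i + 1) - d.τ i) := fun θ => by
    rw [stageHazard_succ]; field_simp; ring
  simp_rw [key]
  refine Tendsto.div_const ((d.tendsto_stageHazard hθ₀ (by omega) hik).sub ?_) _
  rcases Nat.eq_zero_or_pos i with rfl | hi
  · simpa [stageHazard] using tendsto_const_nhds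
  · exact d.tendsto_stageHazard hθ₀ hi (by omega)

/-- Continuous identifiability: the parameter is a continuous function of the cell probabilities. -/
theorem comap_cellProb_le_nhds (hk : 2 ≤ d.k) {θ₀ : Fin 2 → ℝ} (hθ₀ : θ₀ ∈ paramSpace) :
    comap d.cellProb (𝓝 (d.cellProb θ₀)) ⊓ 𝓟 paramSpace ≤ 𝓝 θ₀ := by
  have hx : d.x 2 - d.x 1 ≠ 0 := (sub_pos.2 (d.x_lt 1 le_rfl hk)).ne'
  -- The logarithm of the rate is affine in the stress, so the first two levels give its slope `θ
  -- 1`, and then `θ 0`.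
  have e1 : ∀ θ ∈ paramSpace,
      (Real.log (d.lam θ 2) - Real.log (d.lam θ 1)) / (d.x 2 - d.x 1) = θ 1 := by
    intro θ hθ
    have hne : θ 0 ≠ 0 := (show 0 < θ 0 from hθ).ne'
    unfold lam rate
    rw [Real.log_mul hne (Real.exp_pos _).ne', Real.log_mul hne (Real.exp_pos _).ne',
      Real.log_exp, Real.log_exp]
    field_simp
    ring
  have e0 : ∀ θ : Fin 2 → ℝ, d.lam θ 1 * Real.exp (-(θ 1 * d.x 1)) = θ 0 := by
    intro θ
    rw [lam, rate, mul_assoc, ← Real.exp_add, add_neg_cancel, Real.exp_zero, mul_one]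
  have hΘ : paramSpace ∈ comap d.cellProb (𝓝 (d.cellProb θ₀)) ⊓ 𝓟 paramSpace :=
    mem_inf_of_right (mem_principal_self _)
  have h1 := d.tendsto_lam hθ₀ (i := 0) (by omega)
  have h2 := d.tendsto_lam hθ₀ (i := 1) (by omega)
  have t1 : Tendsto (fun θ : Fin 2 → ℝ => θ 1)
      (comap d.cellProb (𝓝 (d.cellProb θ₀)) ⊓ 𝓟 paramSpace) (𝓝 (θ₀ 1)) := by
    have := ((h2.log (d.lam_pos hθ₀ 2).ne').sub (h1.log (d.lam_pos hθ₀ 1).ne')).div_const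
      (d.x 2 - d.x 1)
    simp only [zero_add, one_add_one_eq_two] at this
    rw [e1 θ₀ hθ₀] at this
    refine this.congr' ?_
    filter_upwards [hΘ] with θ hθ using e1 θ hθ
  have t0 : Tendsto (fun θ : Fin 2 → ℝ => θ 0)
      (comap d.cellProb (𝓝 (d.cellProb θ₀)) ⊓ 𝓟 paramSpace) (𝓝 (θ₀ 0)) := by
    have := h1.mul ((t1.mul_const (d.x 1)).neg.rexp)
    simp only [zero_add, e0] at this
    exact this
  refine tendsto_id'.1 (tendsto_pi_nhds.2 fun i => ?_)
  fin_cases i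
  · exact t0
  · exact t1

/-- The Jacobian of the cell probabilities has full rank. -/
theorem eq_zero_of_W_mulVec_eq_zero (hk : 2 ≤ d.k) {θ : Fin 2 → ℝ} (hθ : θ ∈ paramSpace)
    {v : Fin 2 → ℝ} (hv : d.W θ *ᵥ v = 0) : v = 0 := by
  -- The rows of `W` are increments of `z` starting from `z 0 = 0`, so the kernel condition passes
  -- to every `z j`.
  have hz : ∀ j ≤ d.L, d.z θ j ⬝ᵥ v = 0 := by
    intro j
    induction j with
    | zero => intro _; simp [z_zero]
    | succ j ih =>
      intro hj
      have := congrFun hv ⟨j, by omega⟩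
      change (d.z θ (j + 1) - d.z θ j) ⬝ᵥ v = 0 at this
      rw [sub_dotProduct, ih (by omega), sub_zero] at this
      exact this
  have hS : ∀ i ≤ d.k, d.hazardGrad θ (d.τ i) ⬝ᵥ v = 0 := by
    intro i hi
    rcases Nat.eq_zero_or_pos i with rfl | h0
    · rw [d.hazardGrad_eq hθ, d.stage_eq (m := 0) (by omega) le_rfl
        fun h => d.τ_strictMono zero_lt_one h.le]
      simp
    · have := hz (d.l i) (d.l_le h0 hi)
      rw [d.z_eq hθ (d.l_pos h0 hi) (d.l_le h0 hi), smul_dotProduct, smul_eq_mul,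
        ← d.τ_eq i h0 hi] at this
      exact (mul_eq_zero.1 this).resolve_left (Real.exp_pos _).ne'
  have hG : ∀ i ≤ d.k, d.hazardGrad θ (d.τ i) = ∑ r ∈ Finset.range i,
        ((d.τ (r + 1) - d.τ r) * d.lam θ (r + 1)) • ![1 / θ 0, d.x (r + 1)] := by
    intro i hi
    rw [d.hazardGrad_eq hθ]
    rcases hi.eq_or_lt with rfl | h
    · obtain ⟨n, hn⟩ : ∃ n, d.k = n + 1 := ⟨d.k - 1, by omega⟩
      rw [hn, d.stage_eq (m := n) (by omega) (d.τ_mono (by omega) (by omega)) (by omega),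
        add_comm, Finset.sum_range_succ]
    · rw [d.stage_eq h le_rfl fun h => d.τ_strictMono (Nat.lt_succ_self i) h.le]
      simp
  -- Increments of the hazard gradient between change points are positive multiples of `(1 / θ 0,
  -- x)`; two distinct levels span the plane.
  have hlev : ∀ i, i + 1 ≤ d.k → 1 / θ 0 * v 0 + d.x (i + 1) * v 1 = 0 := by
    intro i hi
    have h1 := hS (i + 1) hi
    have h2 := hS i (by omega)
    rw [hG _ hi, Finset.sum_range_succ, ← hG i (by omega), add_dotProduct, h2, zero_add,
      smul_dotProduct, smul_eq_mul] at h1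
    have := (mul_eq_zero.1 h1).resolve_left
      (mul_pos (sub_pos.2 (d.τ_strictMono (Nat.lt_succ_self i) hi)) (d.lam_pos hθ (i + 1))).ne'
    simpa [dotProduct, Fin.sum_univ_two] using this
  have hne : 1 / θ 0 ≠ 0 := one_div_ne_zero (show 0 < θ 0 from hθ).ne'
  have h1 := hlev 0 (by omega)
  have h2 := hlev 1 (by omega)
  simp only [zero_add, one_add_one_eq_two] at h1 h2
  have hv1 : v 1 = 0 := by
    have : (d.x 2 - d.x 1) * v 1 = 0 := by linarith
    exact (mul_eq_zero.1 this).resolve_left (sub_pos.2 (d.x_lt 1 le_rfl hk)).ne'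
  have hv0 : v 0 = 0 := by
    rw [hv1, mul_zero, add_zero] at h1
    exact (mul_eq_zero.1 h1).resolve_left hne
  ext i
  fin_cases i
  · exact hv0
  · exact hv1

theorem dotProduct_J_mulVec (β : ℝ) (θ v : Fin 2 → ℝ) :
    v ⬝ᵥ (d.J β θ *ᵥ v) = ∑ j, d.cellProb θ j ^ (β - 1) * (d.W θ *ᵥ v) j ^ 2 := by
  rw [J, ← Matrix.mulVec_mulVec, ← Matrix.mulVec_mulVec, Matrix.dotProduct_mulVec,
    Matrix.vecMul_transpose]
  simp only [dotProduct, Matrix.mulVec_diagonal]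
  exact Finset.sum_congr rfl fun j _ => by ring

/-- The quadratic form of `J` is a positively weighted sum of squares of the entries of `W v`, and
`W` is injective. -/
theorem isUnit_det_J (hk : 2 ≤ d.k) (β : ℝ) {θ : Fin 2 → ℝ} (hθ : θ ∈ paramSpace) :
    IsUnit (d.J β θ).det := by
  rw [isUnit_iff_ne_zero]
  intro h
  obtain ⟨v, hv, hJ⟩ := Matrix.exists_mulVec_eq_zero_iff.2 h
  apply hv
  have h0 := d.dotProduct_J_mulVec β θ v
  rw [hJ, dotProduct_zero] at h0
  have hpos : ∀ j, 0 < d.cellProb θ j ^ (β - 1) := fun j =>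
    Real.rpow_pos_of_pos (d.cellProb_pos hθ j) _
  have := (Finset.sum_eq_zero_iff_of_nonneg fun j _ =>
    mul_nonneg (hpos j).le (sq_nonneg _)).1 h0.symm
  refine d.eq_zero_of_W_mulVec_eq_zero hk hθ (funext fun j => ?_)
  have := (mul_eq_zero.1 (this j (Finset.mem_univ j))).resolve_left (hpos j).ne'
  simpa using this

end StepStressPlan

/-! ### The summands of the density power divergence -/

/-- Summand of the density power divergence, normalized at `β = 0` to be nonnegative. -/
def dpdCell (β p q : ℝ) : ℝ :=
  if β = 0 then p * Real.log (p / q) - p + q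
  else q ^ (1 + β) - (1 + 1 / β) * (p * q ^ β) + 1 / β * p ^ (β + 1)

/-- The normalization at `β = 0` makes one formula serve all `β`. Its sign for `β ≥ 0` is that of `q
- p`, and it is also the source of the score. -/
theorem hasDerivAt_dpdCell (β p : ℝ) {q : ℝ} (hq : 0 < q) :
    HasDerivAt (dpdCell β p) ((1 + β) * (q ^ (β - 1) * (q - p))) q := by
  by_cases hβ : β = 0
  · have h : HasDerivAt (fun q => p * Real.log p - p * Real.log q - p + q)
        (0 - p * q⁻¹ - 0 + 1) q :=
      ((((hasDerivAt_const _ _).sub ((Real.hasDerivAt_log hq.ne').const_mul p)).sub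
        (hasDerivAt_const _ _)).add (hasDerivAt_id q))
    have he : dpdCell β p =ᶠ[𝓝 q] fun q => p * Real.log p - p * Real.log q - p + q := by
      filter_upwards [lt_mem_nhds hq] with y hy
      rw [dpdCell, if_pos hβ]
      rcases eq_or_ne p 0 with rfl | hp
      · simp
      · rw [Real.log_div hp hy.ne']
        ring
    convert! h.congr_of_eventuallyEq he using 1
    rw [hβ, zero_sub, Real.rpow_neg_one]
    field_simp
    ring
  · have h : HasDerivAt (fun q => q ^ (1 + β) - (1 + 1 / β) * (p * q ^ β) + 1 / β * p ^ (β + 1))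
        ((1 + β) * q ^ (1 + β - 1) - (1 + 1 / β) * (p * (β * q ^ (β - 1)))) q :=
      ((Real.hasDerivAt_rpow_const (Or.inl hq.ne')).sub
        (((Real.hasDerivAt_rpow_const (Or.inl hq.ne')).const_mul p).const_mul _)).add_const _
    have he : dpdCell β p =
        fun q => q ^ (1 + β) - (1 + 1 / β) * (p * q ^ β) + 1 / β * p ^ (β + 1) := by
      funext q
      rw [dpdCell, if_neg hβ]
    rw [he]
    convert! h using 1
    rw [show 1 + β - 1 = (β - 1) + 1 by ring, Real.rpow_add_one hq.ne']
    field_simp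
    ring

theorem dpdCell_self (β : ℝ) {p : ℝ} (hp : 0 < p) : dpdCell β p p = 0 := by
  unfold dpdCell
  split_ifs with hβ
  · simp [hp.ne']
  · rw [add_comm 1 β, Real.rpow_add_one hp.ne']
    ring

theorem continuousOn_dpdCell (β p : ℝ) : ContinuousOn (dpdCell β p) (Set.Ioi 0) := fun _ hq =>
  (hasDerivAt_dpdCell β p hq).continuousAt.continuousWithinAt

theorem dpdCell_strictMonoOn {β : ℝ} (hβ : 0 ≤ β) {p : ℝ} (hp : 0 < p) :
    StrictMonoOn (dpdCell β p) (Set.Ici p) := by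
  refine strictMonoOn_of_deriv_pos (convex_Ici p)
    ((continuousOn_dpdCell β p).mono fun q hq => hp.trans_le hq) fun q hq => ?_
  rw [interior_Ici] at hq
  have hq0 : 0 < q := hp.trans hq
  rw [(hasDerivAt_dpdCell β p hq0).deriv]
  exact mul_pos (by linarith) (mul_pos (Real.rpow_pos_of_pos hq0 _) (sub_pos.2 hq))

theorem dpdCell_strictAntiOn {β : ℝ} (hβ : 0 ≤ β) {p : ℝ} :
    StrictAntiOn (dpdCell β p) (Set.Ioc 0 p) := by
  refine strictAntiOn_of_deriv_neg (convex_Ioc 0 p)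
    ((continuousOn_dpdCell β p).mono fun q hq => hq.1) fun q hq => ?_
  rw [interior_Ioc] at hq
  rw [(hasDerivAt_dpdCell β p hq.1).deriv]
  exact mul_neg_of_pos_of_neg (by linarith)
    (mul_neg_of_pos_of_neg (Real.rpow_pos_of_pos hq.1 _) (sub_neg.2 hq.2))

theorem dpdCell_pos {β : ℝ} (hβ : 0 ≤ β) {p q : ℝ} (hp : 0 < p) (hq : 0 < q) (hpq : q ≠ p) :
    0 < dpdCell β p q := by
  rw [← dpdCell_self β hp]
  rcases hpq.lt_or_gt with h | h
  · exact dpdCell_strictAntiOn hβ ⟨hq, h.le⟩ ⟨hp, le_rfl⟩ h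
  · exact dpdCell_strictMonoOn hβ hp (Set.mem_Ici.2 le_rfl) (Set.mem_Ici.2 h.le) h

theorem dpdCell_nonneg {β : ℝ} (hβ : 0 ≤ β) {p q : ℝ} (hp : 0 < p) (hq : 0 < q) :
    0 ≤ dpdCell β p q := by
  rcases eq_or_ne q p with rfl | h
  · exact (dpdCell_self β hq).ge
  · exact (dpdCell_pos hβ hp hq h).le

theorem continuousAt_dpdCell_left (β : ℝ) {p q : ℝ} (hp : 0 < p) (hq : 0 < q) :
    ContinuousAt (fun p => dpdCell β p q) p := by
  unfold dpdCell
  split_ifs with hβ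
  · exact ((continuousAt_id.mul ((continuousAt_id.div_const q).log (div_pos hp hq).ne')).sub
      continuousAt_id).add_const q
  · exact (continuousAt_const.sub ((continuousAt_id.mul_const _).const_mul _)).add
      ((continuousAt_id.rpow_const (Or.inl hp.ne')).const_mul _)

/-- The divergence summand is bounded below away from the diagonal, locally uniformly in the first
argument. -/
theorem exists_le_dpdCell {β : ℝ} (hβ : 0 ≤ β) {r ε : ℝ} (hr : 0 < r) (hε : 0 < ε) :
    ∃ c > 0, ∀ᶠ p in 𝓝 r, ∀ q > 0, ε ≤ |q - r| → c ≤ dpdCell β p q := by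
  -- `δ < r` keeps `r - δ` in the domain, and `δ ≤ ε` puts every admissible `q` beyond one of `r ±
  -- δ`. For `p` between these two points monotonicity reduces the bound to them; halving the values
  -- at `p = r` leaves room to vary `p`.
  obtain ⟨δ, hδ0, hδε, hδr⟩ : ∃ δ > 0, δ ≤ ε ∧ δ < r :=
    ⟨min ε (r / 2), by positivity, min_le_left _ _, (min_le_right _ _).trans_lt (by linarith)⟩
  have h1 : 0 < dpdCell β r (r + δ) := dpdCell_pos hβ hr (by linarith) (by linarith)
  have h2 : 0 < dpdCell β r (r - δ) := dpdCell_pos hβ hr (by linarith) (by linarith)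
  refine ⟨min (dpdCell β r (r + δ) / 2) (dpdCell β r (r - δ) / 2), by positivity, ?_⟩
  filter_upwards [lt_mem_nhds (show r - δ < r by linarith), gt_mem_nhds (show r < r + δ by linarith),
    (continuousAt_dpdCell_left β hr (show 0 < r + δ by linarith)).eventually
      (lt_mem_nhds (half_lt_self h1)),
    (continuousAt_dpdCell_left β hr (show 0 < r - δ by linarith)).eventually
      (lt_mem_nhds (half_lt_self h2))] with p hp1 hp2 h3 h4 q hq hqr
  have hp : 0 < p := by linarith
  rcases le_abs.1 hqr with h | h
  · exact (min_le_left _ _).trans (h3.le.trans ((dpdCell_strictMonoOn hβ hp).monotoneOn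
      (Set.mem_Ici.2 hp2.le) (Set.mem_Ici.2 (by linarith)) (by linarith)))
  · exact (min_le_right _ _).trans (h4.le.trans ((dpdCell_strictAntiOn hβ).antitoneOn
      ⟨hq, by linarith⟩ ⟨by linarith, hp1.le⟩ (by linarith)))

/-- The correction at `β = 0` does not depend on the parameter, because model probabilities sum to
one; the minimizers are therefore unchanged. -/
theorem dpd_eq_sum_dpdCell {n : ℕ} (β : ℝ) (p q : Fin n → ℝ) :
    StepStressPlan.dpd β p q =
      ∑ j, dpdCell β (p j) (q j) + if β = 0 then ∑ j, p j - ∑ j, q j else 0 := by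
  unfold StepStressPlan.dpd dpdCell
  split_ifs
  · rw [← Finset.sum_sub_distrib, ← Finset.sum_add_distrib]
    exact Finset.sum_congr rfl fun j _ => by ring
  · simp

/-! ### Consistency and first-order conditions of the estimating problem -/

namespace StepStressPlan

variable (d : StepStressPlan)

/-- Normalized divergence between `p` and the model. -/
def objective (β : ℝ) (p : Fin (d.L + 1) → ℝ) (θ : Fin 2 → ℝ) : ℝ :=
  ∑ j, dpdCell β (p j) (d.cellProb θ j)

theorem isMDPDE_iff {β : ℝ} {p : Fin (d.L + 1) → ℝ} {θ : Fin 2 → ℝ} :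
    d.IsMDPDE β p θ ↔ θ ∈ paramSpace ∧ IsMinOn (d.objective β p) paramSpace θ := by
  unfold IsMDPDE
  refine and_congr_right fun _ => ?_
  simp only [isMinOn_iff, dpd_eq_sum_dpdCell, sum_cellProb, add_le_add_iff_right]
  rfl

theorem hasFDerivAt_objective (β : ℝ) (p : Fin (d.L + 1) → ℝ) {θ : Fin 2 → ℝ}
    (hθ : θ ∈ paramSpace) :
    HasFDerivAt (d.objective β p) (∑ j, ((1 + β) * (d.cellProb θ j ^ (β - 1) *
      (d.cellProb θ j - p j))) • dotCLM (d.W θ j)) θ :=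
  HasFDerivAt.fun_sum fun j _ =>
    HasDerivAt.comp_hasFDerivAt (h₂ := dpdCell β (p j)) (f := fun θ => d.cellProb θ j) θ
      (hasDerivAt_dpdCell β (p j) (d.cellProb_pos hθ j)) (d.hasFDerivAt_cellProb hθ j)

/-- A cell probability off by at least `ε` costs a fixed amount, the other summands being
nonnegative, whereas the objective at `θ₀` tends to zero. Continuous identifiability turns closeness
of probabilities into closeness of parameters. -/
theorem eventually_mem_of_objective_le (hk : 2 ≤ d.k) {β : ℝ} (hβ : 0 ≤ β) {θ₀ : Fin 2 → ℝ}
    (hθ₀ : θ₀ ∈ paramSpace) {V : Set (Fin 2 → ℝ)} (hV : V ∈ 𝓝 θ₀) :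
    ∀ᶠ p in 𝓝 (d.cellProb θ₀), ∀ θ ∈ paramSpace,
      d.objective β p θ ≤ d.objective β p θ₀ → θ ∈ V := by
  obtain ⟨U, hU, hUV⟩ := mem_comap.1 (mem_inf_principal.1 (d.comap_cellProb_le_nhds hk hθ₀ hV))
  obtain ⟨ε, hε, hεU⟩ := Metric.mem_nhds_iff.1 hU
  choose c hc hcp using fun j => exists_le_dpdCell hβ (d.cellProb_pos hθ₀ j) hε
  have hj : ∀ j, Tendsto (fun p : Fin (d.L + 1) → ℝ => p j) (𝓝 (d.cellProb θ₀))
      (𝓝 (d.cellProb θ₀ j)) := fun j => (continuous_apply j).continuousAt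
  have hobj : Tendsto (fun p => d.objective β p θ₀) (𝓝 (d.cellProb θ₀)) (𝓝 0) := by
    have : Tendsto (fun p => d.objective β p θ₀) (𝓝 (d.cellProb θ₀))
        (𝓝 (d.objective β (d.cellProb θ₀) θ₀)) :=
      tendsto_finsetSum _ fun j _ => (continuousAt_dpdCell_left β (d.cellProb_pos hθ₀ j)
        (d.cellProb_pos hθ₀ j)).tendsto.comp (hj j)
    rwa [objective, Finset.sum_eq_zero fun j _ => dpdCell_self β (d.cellProb_pos hθ₀ j)] at this
  filter_upwards [eventually_all.2 fun j => (hj j).eventually (hcp j),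
    eventually_all.2 fun j => (hj j).eventually (lt_mem_nhds (d.cellProb_pos hθ₀ j)),
    eventually_all.2 fun j => hobj.eventually (gt_mem_nhds (hc j))] with p h1 h2 h3 θ hθ hle
  refine hUV (hεU ?_) hθ
  rw [Metric.mem_ball, dist_pi_lt_iff hε]
  intro j
  by_contra! hcon
  have e1 := h1 j _ (d.cellProb_pos hθ j) hcon
  have e2 : dpdCell β (p j) (d.cellProb θ j) ≤ d.objective β p θ :=
    Finset.single_le_sum (f := fun j => dpdCell β (p j) (d.cellProb θ j))
      (fun i _ => dpdCell_nonneg hβ (h2 i) (d.cellProb_pos hθ i)) (Finset.mem_univ j)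
  linarith [h3 j]

/-- Minimum density power divergence estimates exist and are close to the true parameter when the
data are close to the true cell probabilities. -/
theorem eventually_isMDPDE (hk : 2 ≤ d.k) {β : ℝ} (hβ : 0 ≤ β) {θ₀ : Fin 2 → ℝ}
    (hθ₀ : θ₀ ∈ paramSpace) {V : Set (Fin 2 → ℝ)} (hV : V ∈ 𝓝 θ₀) :
    ∀ᶠ p in 𝓝 (d.cellProb θ₀), (∃ θ, d.IsMDPDE β p θ) ∧ ∀ θ, d.IsMDPDE β p θ → θ ∈ V := by
  obtain ⟨r, hr, hrΘ⟩ := Metric.nhds_basis_closedBall.mem_iff.1 (isOpen_paramSpace.mem_nhds hθ₀)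
  filter_upwards [d.eventually_mem_of_objective_le hk hβ hθ₀ hV,
    d.eventually_mem_of_objective_le hk hβ hθ₀ (Metric.closedBall_mem_nhds θ₀ hr)] with p h1 h2
  refine ⟨?_, fun θ h => ?_⟩
  · have hcont : ContinuousOn (d.objective β p) (Metric.closedBall θ₀ r) := fun θ hθ =>
      (d.hasFDerivAt_objective β p (hrΘ hθ)).continuousAt.continuousWithinAt
    obtain ⟨θ₁, hθ₁, hmin⟩ := (isCompact_closedBall θ₀ r).exists_isMinOn
      (Metric.nonempty_closedBall.2 hr.le) hcont
    have h0 : d.objective β p θ₁ ≤ d.objective β p θ₀ :=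
      isMinOn_iff.1 hmin _ (Metric.mem_closedBall_self hr.le)
    refine ⟨θ₁, d.isMDPDE_iff.2 ⟨hrΘ hθ₁, isMinOn_iff.2 fun θ hθ => ?_⟩⟩
    -- A parameter no worse than `θ₀` lies in the ball, where `θ₁` is optimal; any other loses to
    -- `θ₀`, hence to `θ₁`.
    rcases le_total (d.objective β p θ) (d.objective β p θ₀) with hle | hle
    · exact isMinOn_iff.1 hmin _ (h2 θ hθ hle)
    · exact h0.trans hle
  · rw [isMDPDE_iff] at h
    exact h1 θ h.1 (isMinOn_iff.1 h.2 _ hθ₀)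

/-- Estimating function of the minimum density power divergence estimator. -/
def score (β : ℝ) (p : Fin (d.L + 1) → ℝ) (θ : Fin 2 → ℝ) : Fin 2 → ℝ :=
  ∑ j, (d.cellProb θ j - p j) • (d.cellProb θ j ^ (β - 1) • d.W θ j)

theorem IsMDPDE.score_eq_zero {d : StepStressPlan} {β : ℝ} (hβ : 0 ≤ β)
    {p : Fin (d.L + 1) → ℝ} {θ : Fin 2 → ℝ} (h : d.IsMDPDE β p θ) : d.score β p θ = 0 := by
  rw [isMDPDE_iff] at h
  have h0 := (h.2.isLocalMin (isOpen_paramSpace.mem_nhds h.1)).hasFDerivAt_eq_zero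
    (d.hasFDerivAt_objective β p h.1)
  ext i
  have h1 := DFunLike.congr_fun h0 (Pi.single i 1)
  simp only [_root_.sum_apply, _root_.smul_apply, dotCLM_apply,
    dotProduct_single, mul_one, smul_eq_mul, _root_.zero_apply, mul_assoc] at h1
  rw [← Finset.mul_sum] at h1
  have h2 := (mul_eq_zero.1 h1).resolve_left (by positivity)
  rw [score, Finset.sum_apply, Pi.zero_apply, ← h2]
  exact Finset.sum_congr rfl fun j _ => by simp only [Pi.smul_apply, smul_eq_mul]; ring

end StepStressPlan

/-! ### Differentiability of solutions of an estimating equation -/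

section Asymptotics

variable {E F G : Type*} [NormedAddCommGroup E] [NormedSpace ℝ E] [NormedAddCommGroup F]
  [NormedSpace ℝ F] [NormedAddCommGroup G] [NormedSpace ℝ G]

/-- A product is differentiable at a zero of one factor at which the other is only continuous. -/
theorem HasFDerivAt.smul_of_eq_zero {u : E → ℝ} {c : E → F} {x : E} {u' : E →L[ℝ] ℝ}
    (hu : HasFDerivAt u u' x) (h0 : u x = 0) (hc : ContinuousAt c x) :
    HasFDerivAt (fun y => u y • c y) (u'.smulRight (c x)) x := by
  rw [hasFDerivAt_iff_isLittleO]
  -- Since `u` vanishes at `x`, it is of the order of the displacement, and the other factor tends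
  -- to zero.
  have h1 : (fun y => u y • (c y - c x)) =o[𝓝 x] fun y => y - x := by
    have hO : u =O[𝓝 x] fun y => y - x := by simpa [h0] using hu.isBigO_sub
    have ho : (fun y => c y - c x) =o[𝓝 x] fun _ => (1 : ℝ) :=
      (Asymptotics.isLittleO_one_iff ℝ).2 (by simpa using hc.tendsto.sub_const (c x))
    refine (hO.norm_right.smul_isLittleO ho).norm_right.congr_right ?_ |>.of_norm_right
    intro y
    simp
  have h2 : (fun y => (u y - u x - u' (y - x)) • c x) =o[𝓝 x] fun y => y - x := by
    have := (hasFDerivAt_iff_isLittleO.1 hu).norm_right.smul_isBigO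
      (Asymptotics.isBigO_refl (fun _ : E => c x) (𝓝 x))
    refine (this.trans_isBigO ?_)
    refine Asymptotics.IsBigO.of_bound ‖c x‖ (Eventually.of_forall fun y => ?_)
    rw [norm_smul, norm_norm, mul_comm]
  refine (h1.add h2).congr_left fun y => ?_
  rw [h0, ContinuousLinearMap.smulRight_apply]
  module

/-- Solutions of an estimating equation `Ψ = 0` are differentiable functions of the data. -/
theorem isLittleO_of_hasFDerivAt_of_eq_zero {Ψ : E × F → F} {e : E} {f : F} {A A' : F →L[ℝ] F}
    {B : E →L[ℝ] F} (hΨ : HasFDerivAt Ψ (A.comp (ContinuousLinearMap.snd ℝ E F) -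
      B.comp (ContinuousLinearMap.fst ℝ E F)) (e, f)) (hA : ∀ v, A' (A v) = v) (h0 : Ψ (e, f) = 0) :
    (fun x : E × F => x.2 - f - A' (B (x.1 - e))) =o[𝓝 (e, f) ⊓ 𝓟 {x | Ψ x = 0}]
      fun x => x.1 - e := by
  set l := 𝓝 (e, f) ⊓ 𝓟 {x | Ψ x = 0}
  have h1 : (fun x : E × F => A (x.2 - f) - B (x.1 - e)) =o[l] fun x => x - (e, f) := by
    have := ((hasFDerivAt_iff_isLittleO.1 hΨ).mono (inf_le_left : l ≤ _)).neg_left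
    refine this.congr' ?_ EventuallyEq.rfl
    filter_upwards [mem_inf_of_right (mem_principal_self _)] with x hx
    have hx0 : Ψ x = 0 := hx
    simp [hx0, h0]
  have h2 : (fun x : E × F => x.2 - f - A' (B (x.1 - e))) =o[l] fun x => x - (e, f) := by
    refine (A'.isBigO_comp _ l).trans_isLittleO h1 |>.congr_left fun x => ?_
    rw [map_sub, hA]
  -- The remainder is so far small only relative to the joint displacement. Subtracting it from that
  -- displacement leaves `(x.1 - e, A' (B (x.1 - e)))`, so the displacement is controlled by the
  -- data alone.
  have h3 : (fun x : E × F => x - (e, f)) =O[l] fun x => x.1 - e := by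
    have h4 : (fun x : E × F => ((0 : E), x.2 - f - A' (B (x.1 - e)))) =o[l] fun x => x - (e, f) := by
      refine Asymptotics.IsLittleO.of_norm_left (h2.norm_left.congr_left fun x => ?_)
      simp
    refine h4.right_isBigO_sub.trans ?_
    have h5 : (fun x : E × F => (x.1 - e, A' (B (x.1 - e)))) =O[l] fun x => x.1 - e :=
      (Asymptotics.isBigO_refl _ l).prod_left ((A'.comp B).isBigO_comp _ l)
    refine h5.congr_left fun x => ?_
    ext <;> simp
  exact h2.trans_isBigO h3

theorem isLittleO_comp_of_hasFDerivAt_of_eq_zero {Ψ : E × F → F} {e : E} {f : F}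
    {A A' : F →L[ℝ] F} {B : E →L[ℝ] F} (hΨ : HasFDerivAt Ψ (A.comp (ContinuousLinearMap.snd ℝ E F) -
      B.comp (ContinuousLinearMap.fst ℝ E F)) (e, f)) (hA : ∀ v, A' (A v) = v) (h0 : Ψ (e, f) = 0)
    {h : F → G} {g : F →L[ℝ] G} (hh : HasFDerivAt h g f) :
    (fun x : E × F => h x.2 - h f - g (A' (B (x.1 - e)))) =o[𝓝 (e, f) ⊓ 𝓟 {x | Ψ x = 0}]
      fun x => x.1 - e := by
  have h1 := isLittleO_of_hasFDerivAt_of_eq_zero hΨ hA h0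
  set l := 𝓝 (e, f) ⊓ 𝓟 {x | Ψ x = 0}
  have hl : Tendsto (fun x : E × F => x.2) l (𝓝 f) :=
    (continuous_snd.tendsto (e, f)).mono_left inf_le_left
  have h2 : (fun x : E × F => x.2 - f) =O[l] fun x => x.1 - e :=
    (h1.isBigO.add ((A'.comp B).isBigO_comp _ l)).congr_left fun x => by simp
  have h3 := ((hasFDerivAt_iff_isLittleO.1 hh).comp_tendsto hl).trans_isBigO h2
  refine (h3.add ((g.isBigO_comp _ l).trans_isLittleO h1)).congr_left fun x => ?_
  simp only [Function.comp_apply, map_sub]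
  abel

end Asymptotics

/-! ### Linearization of the estimating equation. -/

namespace StepStressPlan

variable (d : StepStressPlan)

/-- Each summand is a residual, zero at the true pair, times a continuous weight, so only the
residual is differentiated. -/
theorem hasFDerivAt_score (β : ℝ) {θ₀ : Fin 2 → ℝ} (hθ₀ : θ₀ ∈ paramSpace) :
    HasFDerivAt (fun x : (Fin (d.L + 1) → ℝ) × (Fin 2 → ℝ) => d.score β x.1 x.2)
      ((LinearMap.toContinuousLinearMap (d.J β θ₀).mulVecLin).comp
          (ContinuousLinearMap.snd ℝ _ _) -
        (LinearMap.toContinuousLinearMap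
          ((d.W θ₀)ᵀ * Matrix.diagonal fun j => d.cellProb θ₀ j ^ (β - 1)).mulVecLin).comp
          (ContinuousLinearMap.fst ℝ _ _)) (d.cellProb θ₀, θ₀) := by
  have hsnd : ContinuousAt (fun x : (Fin (d.L + 1) → ℝ) × (Fin 2 → ℝ) => x.2)
      (d.cellProb θ₀, θ₀) := continuous_snd.continuousAt
  have hu : ∀ j : Fin (d.L + 1), HasFDerivAt
      (fun x : (Fin (d.L + 1) → ℝ) × (Fin 2 → ℝ) => d.cellProb x.2 j - x.1 j)
      ((dotCLM (d.W θ₀ j)).comp (ContinuousLinearMap.snd ℝ _ _) -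
        (ContinuousLinearMap.proj (R := ℝ) (φ := fun _ => ℝ) j).comp
          (ContinuousLinearMap.fst ℝ _ _)) (d.cellProb θ₀, θ₀) := fun j =>
    (HasFDerivAt.comp (g := fun θ => d.cellProb θ j) (d.cellProb θ₀, θ₀)
      (d.hasFDerivAt_cellProb hθ₀ j) hasFDerivAt_snd).sub
      (HasFDerivAt.comp (g := fun p : Fin (d.L + 1) → ℝ => p j) (d.cellProb θ₀, θ₀)
        (hasFDerivAt_apply j _) hasFDerivAt_fst)
  have h := HasFDerivAt.fun_sum (u := Finset.univ) fun (j : Fin (d.L + 1)) _ =>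
    HasFDerivAt.smul_of_eq_zero (x := (d.cellProb θ₀, θ₀))
      (u := fun x : (Fin (d.L + 1) → ℝ) × (Fin 2 → ℝ) => d.cellProb x.2 j - x.1 j)
      (c := fun x => d.cellProb x.2 j ^ (β - 1) • d.W x.2 j)
      (hu j) (sub_self _)
      ((ContinuousAt.rpow_const (ContinuousAt.comp (f := fun x :
          (Fin (d.L + 1) → ℝ) × (Fin 2 → ℝ) => x.2) (g := fun θ => d.cellProb θ j)
          (d.hasFDerivAt_cellProb hθ₀ j).continuousAt hsnd)
          (Or.inl (d.cellProb_pos hθ₀ j).ne')).smul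
        (ContinuousAt.comp (f := fun x :
          (Fin (d.L + 1) → ℝ) × (Fin 2 → ℝ) => x.2) (g := fun θ => d.W θ j)
          (d.continuousAt_W hθ₀ j) hsnd))
  unfold score
  refine h.congr_fderiv (ContinuousLinearMap.ext fun v => ?_)
  simp only [_root_.sum_apply, ContinuousLinearMap.smulRight_apply, _root_.sub_apply,
    ContinuousLinearMap.comp_apply, ContinuousLinearMap.coe_snd', ContinuousLinearMap.coe_fst',
    dotCLM_apply, ContinuousLinearMap.proj_apply, LinearMap.coe_toContinuousLinearMap',
    Matrix.mulVecLin_apply]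
  rw [J, ← Matrix.mulVec_mulVec, ← Matrix.mulVec_sub, ← Matrix.mulVec_mulVec]
  ext i
  rw [Finset.sum_apply]
  simp only [Matrix.mulVec, dotProduct, Matrix.transpose_apply, Pi.smul_apply, smul_eq_mul,
    Pi.sub_apply, Matrix.diagonal_apply, ite_mul, zero_mul, Finset.sum_ite_eq, Finset.mem_univ,
    if_true]
  exact Finset.sum_congr rfl fun j _ => by ring

theorem score_self (β : ℝ) (θ : Fin 2 → ℝ) : d.score β (d.cellProb θ) θ = 0 := by
  simp [score]

/-- Linear expansion of a smooth function of minimum density power divergence estimates in terms of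
the data. -/
theorem eventually_isMDPDE_expansion (hk : 2 ≤ d.k) {β : ℝ} (hβ : 0 ≤ β) {θ₀ : Fin 2 → ℝ}
    (hθ₀ : θ₀ ∈ paramSpace) {h : (Fin 2 → ℝ) → ℝ} {g : Fin 2 → ℝ}
    (hh : HasFDerivAt h (dotCLM g) θ₀) {ε : ℝ} (hε : 0 < ε) :
    ∀ᶠ p in 𝓝 (d.cellProb θ₀), (∃ θ, d.IsMDPDE β p θ) ∧ ∀ θ, d.IsMDPDE β p θ →
      |h θ - h θ₀ - g ⬝ᵥ ((d.J β θ₀)⁻¹ *ᵥ (((d.W θ₀)ᵀ *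
        Matrix.diagonal fun j => d.cellProb θ₀ j ^ (β - 1)) *ᵥ (p - d.cellProb θ₀)))| ≤
      ε * ‖p - d.cellProb θ₀‖ := by
  have hexp := isLittleO_comp_of_hasFDerivAt_of_eq_zero
    (A' := LinearMap.toContinuousLinearMap ((d.J β θ₀)⁻¹).mulVecLin)
    (d.hasFDerivAt_score β hθ₀) (fun v => by
      change (d.J β θ₀)⁻¹ *ᵥ (d.J β θ₀ *ᵥ v) = v
      rw [Matrix.mulVec_mulVec, Matrix.nonsing_inv_mul _ (d.isUnit_det_J hk β hθ₀),
        Matrix.one_mulVec]) (d.score_self β θ₀) hh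
  have hev := hexp.def hε
  rw [eventually_inf_principal, nhds_prod_eq] at hev
  -- The expansion holds on a product neighbourhood; consistency places every minimizer in its
  -- parameter factor.
  obtain ⟨U, hU, V, hV, hUV⟩ := eventually_prod_iff.1 hev
  filter_upwards [hU, d.eventually_isMDPDE hk hβ hθ₀ hV] with p hp hpV
  refine ⟨hpV.1, fun θ hθ => ?_⟩
  exact hUV hp (hpV.2 θ hθ) (hθ.score_eq_zero hβ)

end StepStressPlan

namespace StepStressPlan

/-! ### The reliability and the asymptotic variance -/

theorem hasFDerivAt_reliability (x₀ t : ℝ) {θ : Fin 2 → ℝ} (hθ : θ ∈ paramSpace) :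
    HasFDerivAt (reliability x₀ t) (dotCLM (reliabilityGrad x₀ t θ)) θ := by
  have h := ((hasFDerivAt_rate hθ x₀).mul_const t).neg.exp
  refine HasFDerivAt.congr_fderiv (f := reliability x₀ t) h (ContinuousLinearMap.ext fun v => ?_)
  change Real.exp (-(rate θ x₀ * t)) * -(t * ((rate θ x₀ • ![1 / θ 0, x₀]) ⬝ᵥ v)) =
    ![-(Real.exp (-(rate θ x₀ * t)) * (rate θ x₀ * t / θ 0)),
      -(Real.exp (-(rate θ x₀ * t)) * (rate θ x₀ * t * x₀))] ⬝ᵥ v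
  simp [dotProduct, Fin.sum_univ_two]
  ring

/-- A gradient requires an inner product, hence the passage to `EuclideanSpace`. -/
theorem hasGradientAt_reliability (x₀ t : ℝ) {θ : EuclideanSpace ℝ (Fin 2)}
    (hθ : θ.ofLp ∈ paramSpace) :
    HasGradientAt (fun θ' : EuclideanSpace ℝ (Fin 2) => reliability x₀ t θ'.ofLp)
      (WithLp.toLp 2 (reliabilityGrad x₀ t θ.ofLp)) θ := by
  rw [hasGradientAt_iff_hasFDerivAt]
  have h := HasFDerivAt.comp θ (hasFDerivAt_reliability x₀ t hθ)
    (PiLp.continuousLinearEquiv 2 ℝ fun _ : Fin 2 => ℝ).hasFDerivAt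
  refine HasFDerivAt.congr_fderiv h (ContinuousLinearMap.ext fun v => ?_)
  rw [InnerProductSpace.toDual_apply_apply, EuclideanSpace.inner_eq_star_dotProduct,
    dotProduct_comm]
  rfl

variable (d : StepStressPlan)

/-- Influence weights of the cells on the linear functional with gradient `g`. -/
def influence (β : ℝ) (θ g : Fin 2 → ℝ) (j : Fin (d.L + 1)) : ℝ :=
  d.cellProb θ j ^ (β - 1) * (d.W θ *ᵥ ((d.J β θ)⁻¹ *ᵥ g)) j

theorem transpose_J_inv (β : ℝ) (θ : Fin 2 → ℝ) : ((d.J β θ)⁻¹)ᵀ = (d.J β θ)⁻¹ := by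
  rw [Matrix.transpose_nonsing_inv]
  congr 1
  simp [J, Matrix.transpose_mul, Matrix.mul_assoc]

theorem dotProduct_J_inv_mulVec (β : ℝ) (θ g v : Fin 2 → ℝ) :
    g ⬝ᵥ ((d.J β θ)⁻¹ *ᵥ v) = ((d.J β θ)⁻¹ *ᵥ g) ⬝ᵥ v := by
  rw [Matrix.dotProduct_mulVec, ← Matrix.mulVec_transpose, transpose_J_inv]

theorem influence_dotProduct (β : ℝ) (θ g : Fin 2 → ℝ) (v : Fin (d.L + 1) → ℝ) :
    g ⬝ᵥ ((d.J β θ)⁻¹ *ᵥ (((d.W θ)ᵀ *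
        Matrix.diagonal fun j => d.cellProb θ j ^ (β - 1)) *ᵥ v)) = d.influence β θ g ⬝ᵥ v := by
  rw [dotProduct_J_inv_mulVec, ← Matrix.mulVec_mulVec, Matrix.dotProduct_mulVec,
    Matrix.vecMul_transpose]
  simp only [dotProduct, Matrix.mulVec_diagonal, influence]
  exact Finset.sum_congr rfl fun j _ => by ring

/-- The right side is the variance of the influence weight of the cell of one lifetime. The powers
match because `(π ^ (β - 1)) ^ 2 * π = π ^ (2 * β - 1)` and `π ^ (β - 1) * π = π ^ β`. -/
theorem reliabilityVar_eq (β x₀ t : ℝ) {θ : Fin 2 → ℝ} (hθ : θ ∈ paramSpace) :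
    d.reliabilityVar β x₀ t θ =
      ∑ j, d.influence β θ (reliabilityGrad x₀ t θ) j ^ 2 * d.cellProb θ j -
        (∑ j, d.influence β θ (reliabilityGrad x₀ t θ) j * d.cellProb θ j) ^ 2 := by
  rw [reliabilityVar, ← Matrix.mulVec_mulVec, ← Matrix.mulVec_mulVec, dotProduct_J_inv_mulVec]
  unfold influence K
  set u := (d.J β θ)⁻¹ *ᵥ reliabilityGrad x₀ t θ
  rw [← Matrix.mulVec_mulVec, ← Matrix.mulVec_mulVec, Matrix.dotProduct_mulVec,
    Matrix.vecMul_transpose]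
  set w := d.W θ *ᵥ u
  rw [Matrix.sub_mulVec, dotProduct_sub, Matrix.vecMulVec_mulVec]
  have hpow : ∀ j, d.cellProb θ j ^ (β - 1) * d.cellProb θ j = d.cellProb θ j ^ β := fun j => by
    rw [← Real.rpow_add_one (d.cellProb_pos hθ j).ne', sub_add_cancel]
  congr 1
  · simp only [dotProduct, Matrix.mulVec_diagonal]
    refine Finset.sum_congr rfl fun j _ => ?_
    rw [show 2 * β - 1 = (β - 1) + β by ring, Real.rpow_add (d.cellProb_pos hθ j), ← hpow j]
    ring
  · have : ∑ j, d.cellProb θ j ^ (β - 1) * w j * d.cellProb θ j =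
        (fun j => d.cellProb θ j ^ β) ⬝ᵥ w :=
      Finset.sum_congr rfl fun j _ => by
        change _ = d.cellProb θ j ^ β * w j
        rw [← hpow j]; ring
    rw [this, sq]
    simp [dotProduct_comm]

/-! ### Cell frequencies of a sample -/

theorem measurableSet_cell (j : Fin (d.L + 1)) : MeasurableSet (d.cell j) := by
  unfold cell
  split_ifs
  · exact measurableSet_Ioc
  · exact measurableSet_Ioi

theorem insp_mono {i j : ℕ} (hij : i ≤ j) (hj : j ≤ d.L) : d.insp i ≤ d.insp j := by
  rcases hij.eq_or_lt with rfl | h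
  · exact le_rfl
  · exact (d.insp_strictMono h hj).le

theorem disjoint_cell {i j : Fin (d.L + 1)} (hij : i ≠ j) : Disjoint (d.cell i) (d.cell j) := by
  wlog h : i < j generalizing i j
  · exact (this hij.symm (lt_of_le_of_ne (not_lt.1 h) hij.symm)).symm
  have hi : (i : ℕ) < d.L := by have : (i : ℕ) < j := h; omega
  have h1 : ∀ s ∈ d.cell i, s ≤ d.insp (i + 1) := fun s hs => by
    rw [cell, if_pos hi] at hs
    exact hs.2
  have h2 : ∀ s ∈ d.cell j, d.insp j < s := fun s hs => by
    unfold cell at hs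
    split_ifs at hs with hj
    · exact hs.1
    · rwa [show (j : ℕ) = d.L by omega]
  rw [Set.disjoint_left]
  intro s hsi hsj
  exact absurd (h1 s hsi) (not_le.2 ((d.insp_mono (Nat.succ_le_of_lt h) (by omega)).trans_lt
    (h2 s hsj)))

/-- The step function with value `b j` on the `j`-th cell. -/
def cellFun (b : Fin (d.L + 1) → ℝ) (s : ℝ) : ℝ :=
  ∑ j, b j * (d.cell j).indicator 1 s

theorem measurable_cellFun (b : Fin (d.L + 1) → ℝ) : Measurable (d.cellFun b) :=
  Finset.measurable_fun_sum _ fun j _ =>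
    (measurable_one.indicator (d.measurableSet_cell j)).const_mul _

/-- Disjointness of the cells kills the cross terms; at a point in no cell both sides are zero. -/
theorem cellFun_sq (b : Fin (d.L + 1) → ℝ) (s : ℝ) :
    d.cellFun b s ^ 2 = d.cellFun (fun j => b j ^ 2) s := by
  unfold cellFun
  by_cases h : ∃ j, s ∈ d.cell j
  · obtain ⟨j, hj⟩ := h
    have h0 : ∀ i, i ≠ j → (d.cell i).indicator (1 : ℝ → ℝ) s = 0 := fun i hi =>
      Set.indicator_of_notMem (fun his => Set.disjoint_left.1 (d.disjoint_cell hi) his hj) _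
    rw [Finset.sum_eq_single j (fun i _ hi => by rw [h0 i hi, mul_zero]) (by simp),
      Finset.sum_eq_single j (fun i _ hi => by rw [h0 i hi, mul_zero]) (by simp)]
    simp [hj]
  · push Not at h
    simp [h]

theorem sum_cellFun (b : Fin (d.L + 1) → ℝ) (T : ℕ → ℝ) (N : ℕ) :
    ∑ m ∈ Finset.range N, d.cellFun b (T m) = ∑ j, b j * d.count T N j := by
  unfold cellFun
  rw [Finset.sum_comm]
  refine Finset.sum_congr rfl fun j _ => ?_
  rw [← Finset.mul_sum, count, Finset.card_filter]
  push_cast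
  congr 1

theorem inv_sqrt_mul_sum_cellFun (b p : Fin (d.L + 1) → ℝ) (T : ℕ → ℝ) (N : ℕ) :
    (√(N : ℝ))⁻¹ * (∑ m ∈ Finset.range N, d.cellFun b (T m) - N * ∑ j, b j * p j) =
      √(N : ℝ) * (b ⬝ᵥ (d.empirical T N - p)) := by
  rw [sum_cellFun]
  rcases Nat.eq_zero_or_pos N with rfl | hN
  · simp
  · have hN0 : (0 : ℝ) < N := Nat.cast_pos.2 hN
    have hs : √(N : ℝ) ≠ 0 := (Real.sqrt_pos.2 hN0).ne'
    have : b ⬝ᵥ (d.empirical T N - p) =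
        (∑ j, b j * d.count T N j - N * ∑ j, b j * p j) / N := by
      rw [Finset.mul_sum, ← Finset.sum_sub_distrib, Finset.sum_div]
      refine Finset.sum_congr rfl fun j _ => ?_
      simp only [Pi.sub_apply, empirical]
      field_simp
    rw [this]
    field_simp
    rw [Real.sq_sqrt hN0.le]

/-! ### Limit theorems for the cell frequencies and the estimator. -/

section Sample

variable {Ω : Type*} [MeasurableSpace Ω] {P : Measure Ω} [IsProbabilityMeasure P] {θ₀ : Fin 2 → ℝ}

theorem measureReal_cell {X : Ω → ℝ} (hX : Measurable X)
    (hlaw : ∀ s, P.real {ω | X ω ≤ s} = d.cdfT θ₀ s) (j : Fin (d.L + 1)) :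
    P.real (X ⁻¹' d.cell j) = d.cellProb θ₀ j := by
  have hm : ∀ s, MeasurableSet {ω | X ω ≤ s} := fun s => hX measurableSet_Iic
  unfold cell cellProb
  split_ifs with h
  · have he : X ⁻¹' Set.Ioc (d.insp j) (d.insp (j + 1)) =
        {ω | X ω ≤ d.insp (j + 1)} \ {ω | X ω ≤ d.insp j} := by
      ext ω
      simp [and_comm]
    have hsub : {ω | X ω ≤ d.insp j} ⊆ {ω | X ω ≤ d.insp (j + 1)} :=
      fun ω hω => le_trans hω (d.insp_lt j h).le
    rw [he, measureReal_sdiff hsub (hm _), hlaw, hlaw]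
  · have he : X ⁻¹' Set.Ioi (d.insp d.L) = {ω | X ω ≤ d.insp d.L}ᶜ := by
      ext ω
      simp
    rw [he, probReal_compl_eq_one_sub (hm _), hlaw]

theorem memLp_cellFun {X : Ω → ℝ} (hX : Measurable X) (b : Fin (d.L + 1) → ℝ) :
    MemLp (fun ω => d.cellFun b (X ω)) 2 P := by
  refine MemLp.of_bound ((d.measurable_cellFun b).comp hX).aestronglyMeasurable (∑ j, |b j|)
    (ae_of_all _ fun ω => ?_)
  refine (norm_sum_le _ _).trans (Finset.sum_le_sum fun j _ => ?_)
  rw [norm_mul, Real.norm_eq_abs]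
  refine mul_le_of_le_one_right (abs_nonneg _) ?_
  by_cases h : X ω ∈ d.cell j <;> simp [h]

theorem integral_cellFun {X : Ω → ℝ} (hX : Measurable X)
    (hlaw : ∀ s, P.real {ω | X ω ≤ s} = d.cdfT θ₀ s) (b : Fin (d.L + 1) → ℝ) :
    ∫ ω, d.cellFun b (X ω) ∂P = ∑ j, b j * d.cellProb θ₀ j := by
  have he : ∀ j, (fun ω => (d.cell j).indicator (1 : ℝ → ℝ) (X ω)) =
      (X ⁻¹' d.cell j).indicator 1 := fun j => rfl
  unfold cellFun
  rw [integral_finsetSum]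
  · refine Finset.sum_congr rfl fun j _ => ?_
    rw [integral_const_mul, he, integral_indicator_one (hX (d.measurableSet_cell j)),
      d.measureReal_cell hX hlaw]
  · intro j _
    refine Integrable.const_mul ?_ _
    rw [he]
    exact (integrable_const (1 : ℝ)).indicator (hX (d.measurableSet_cell j))

theorem variance_cellFun {X : Ω → ℝ} (hX : Measurable X)
    (hlaw : ∀ s, P.real {ω | X ω ≤ s} = d.cdfT θ₀ s) (b : Fin (d.L + 1) → ℝ) :
    Var[fun ω => d.cellFun b (X ω); P] =
      ∑ j, b j ^ 2 * d.cellProb θ₀ j - (∑ j, b j * d.cellProb θ₀ j) ^ 2 := by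
  rw [variance_eq_sub (d.memLp_cellFun hX b), d.integral_cellFun hX hlaw,
    ← d.integral_cellFun hX hlaw fun j => b j ^ 2]
  simp only [Pi.pow_apply, cellFun_sq]

theorem identDistrib_of_cdf {T : ℕ → Ω → ℝ} (hT : ∀ m, Measurable (T m)) {F : ℝ → ℝ}
    (hlaw : ∀ m s, P.real {ω | T m ω ≤ s} = F s) (m : ℕ) :
    IdentDistrib (T m) (T 0) P P := by
  refine ⟨(hT m).aemeasurable, (hT 0).aemeasurable, ?_⟩
  have := fun m => Measure.isProbabilityMeasure_map (μ := P) (hT m).aemeasurable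
  refine Measure.ext_of_Iic _ _ fun s => ?_
  rw [Measure.map_apply (hT m) measurableSet_Iic, Measure.map_apply (hT 0) measurableSet_Iic,
    ← ENNReal.toReal_eq_toReal_iff' (measure_ne_top _ _) (measure_ne_top _ _)]
  exact (hlaw m s).trans (hlaw 0 s).symm

/-- Only one linear functional matters, so the scalar central limit theorem for the step function
`cellFun b` replaces a multivariate one. -/
theorem tendstoInDistribution_empirical {T : ℕ → Ω → ℝ} (hT : ∀ m, Measurable (T m))
    (hindep : iIndepFun T P) (hlaw : ∀ m s, P.real {ω | T m ω ≤ s} = d.cdfT θ₀ s)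
    (b : Fin (d.L + 1) → ℝ) {v : ℝ}
    (hv : v = ∑ j, b j ^ 2 * d.cellProb θ₀ j - (∑ j, b j * d.cellProb θ₀ j) ^ 2) :
    TendstoInDistribution
      (fun (N : ℕ) ω => √(N : ℝ) *
        (b ⬝ᵥ (d.empirical (fun m => T m ω) N - d.cellProb θ₀))) atTop (id : ℝ → ℝ) (fun _ => P)
      (gaussianReal 0 v.toNNReal) := by
  have hvar : Var[fun ω => d.cellFun b (T 0 ω); P] = v := by
    rw [hv, d.variance_cellFun (hT 0) (hlaw 0)]
  have h := tendstoInDistribution_inv_sqrt_mul_sum_sub (P := P)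
    (X := fun m ω => d.cellFun b (T m ω)) (Y := id) (P' := gaussianReal 0 v.toNNReal)
    (by rw [hvar]; exact HasLaw.id) (d.memLp_cellFun (hT 0) b)
    (hindep.comp (fun _ => d.cellFun b) fun _ => d.measurable_cellFun b)
    (fun m => (identDistrib_of_cdf hT hlaw m).comp (d.measurable_cellFun b))
  simpa only [d.integral_cellFun (hT 0) (hlaw 0), inv_sqrt_mul_sum_cellFun] using h

/-- Chebyshev's inequality for a cell frequency. -/
theorem measure_le_sqrt_mul_empirical_apply {T : ℕ → Ω → ℝ} (hT : ∀ m, Measurable (T m))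
    (hindep : iIndepFun T P) (hlaw : ∀ m s, P.real {ω | T m ω ≤ s} = d.cdfT θ₀ s)
    (j : Fin (d.L + 1)) {N : ℕ} (hN : 0 < N) {M : ℝ} (hM : 0 < M) :
    P {ω | M ≤ √(N : ℝ) * |d.empirical (fun m => T m ω) N j - d.cellProb θ₀ j|} ≤
      ENNReal.ofReal (1 / M ^ 2) := by
  have hN0 : (0 : ℝ) < N := Nat.cast_pos.2 hN
  have hs : 0 < √(N : ℝ) := Real.sqrt_pos.2 hN0
  -- With a unit vector as weights, the step function is the indicator of cell `j` and `S` is its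
  -- count.
  set b : Fin (d.L + 1) → ℝ := Pi.single j 1 with hb
  set S : Ω → ℝ := ∑ m ∈ Finset.range N, fun ω => d.cellFun b (T m ω) with hS
  have hb1 : ∀ q : Fin (d.L + 1) → ℝ, ∑ i, b i * q i = q j := fun q => by
    simp [hb, Pi.single_apply]
  have hb2 : ∀ q : Fin (d.L + 1) → ℝ, ∑ i, b i ^ 2 * q i = q j := fun q => by
    simp [hb, Pi.single_apply, ite_pow]
  have hmem : MemLp S 2 P := memLp_finsetSum' _ fun m _ => d.memLp_cellFun (hT m) b
  have hmean : ∫ ω, S ω ∂P = N * d.cellProb θ₀ j := by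
    simp only [hS, Finset.sum_apply]
    rw [integral_finsetSum _ fun m _ => (d.memLp_cellFun (hT m) b).integrable one_le_two]
    simp [d.integral_cellFun (hT _) (hlaw _), hb1]
  have hvar : Var[S; P] ≤ N := by
    rw [hS, IndepFun.variance_sum (fun m _ => d.memLp_cellFun (hT m) b) fun m _ m' _ hmm' =>
      (hindep.comp (fun _ => d.cellFun b) fun _ => d.measurable_cellFun b).indepFun hmm']
    have : ∀ m ∈ Finset.range N, Var[fun ω => d.cellFun b (T m ω); P] ≤ 1 := fun m _ => by
      rw [d.variance_cellFun (hT m) (hlaw m), hb1, hb2, ← d.measureReal_cell (hT m) (hlaw m)]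
      -- The variance of an indicator, `p - p ^ 2`, is at most one.
      have h1 : P.real (T m ⁻¹' d.cell j) ≤ 1 := measureReal_le_one
      nlinarith [sq_nonneg (P.real (T m ⁻¹' d.cell j))]
    simpa using Finset.sum_le_sum this
  have hset : {ω | M ≤ √(N : ℝ) * |d.empirical (fun m => T m ω) N j - d.cellProb θ₀ j|} =
      {ω | √(N : ℝ) * M ≤ |S ω - ∫ ω, S ω ∂P|} := by
    ext ω
    have h1 := d.inv_sqrt_mul_sum_cellFun b (d.cellProb θ₀) (fun m => T m ω) N
    rw [dotProduct, hb1, hb1, Pi.sub_apply] at h1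
    have h2 : S ω - ∫ ω, S ω ∂P =
        √(N : ℝ) * (√(N : ℝ) * (d.empirical (fun m => T m ω) N j - d.cellProb θ₀ j)) := by
      rw [← h1, hmean, mul_inv_cancel_left₀ hs.ne', hS, Finset.sum_apply]
    rw [Set.mem_ofPred_eq, Set.mem_ofPred_eq, h2, abs_mul, abs_mul, abs_of_pos hs,
      mul_le_mul_iff_right₀ hs]
  rw [hset]
  refine (meas_ge_le_variance_div_sq hmem (mul_pos hs hM)).trans (ENNReal.ofReal_le_ofReal ?_)
  rw [mul_pow, Real.sq_sqrt hN0.le, div_le_div_iff₀ (by positivity) (by positivity), one_mul]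
  exact mul_le_mul_of_nonneg_right hvar (sq_nonneg M)

/-- Union bound over the cells for the sup norm. The bound is free of `N`, so the rescaled deviation
is bounded in probability. -/
theorem measure_le_sqrt_mul_norm_empirical {T : ℕ → Ω → ℝ} (hT : ∀ m, Measurable (T m))
    (hindep : iIndepFun T P) (hlaw : ∀ m s, P.real {ω | T m ω ≤ s} = d.cdfT θ₀ s)
    {N : ℕ} (hN : 0 < N) {M : ℝ} (hM : 0 < M) :
    P {ω | M ≤ √(N : ℝ) * ‖d.empirical (fun m => T m ω) N - d.cellProb θ₀‖} ≤
      ENNReal.ofReal ((d.L + 1) / M ^ 2) := by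
  have hs : 0 < √(N : ℝ) := Real.sqrt_pos.2 (Nat.cast_pos.2 hN)
  have hsub : {ω | M ≤ √(N : ℝ) * ‖d.empirical (fun m => T m ω) N - d.cellProb θ₀‖} ⊆
      ⋃ j, {ω | M ≤ √(N : ℝ) * |d.empirical (fun m => T m ω) N j - d.cellProb θ₀ j|} := by
    intro ω hω
    by_contra hcon
    simp only [Set.mem_iUnion, Set.mem_ofPred_eq, not_exists, not_le] at hcon hω
    refine absurd hω (not_le.2 ?_)
    rw [← lt_div_iff₀' hs, pi_norm_lt_iff (div_pos hM hs)]
    intro j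
    rw [lt_div_iff₀' hs]
    exact hcon j
  refine (measure_mono hsub).trans ((measure_iUnion_fintype_le _ _).trans
    ((Finset.sum_le_sum fun j _ =>
      d.measure_le_sqrt_mul_empirical_apply hT hindep hlaw j hN hM).trans ?_))
  rw [Finset.sum_const, Finset.card_univ, Fintype.card_fin, ← ENNReal.ofReal_nsmul]
  refine ENNReal.ofReal_le_ofReal (le_of_eq ?_)
  rw [nsmul_eq_mul]
  push_cast
  ring

/-- The delta method for minimum density power divergence estimators. -/
theorem tendstoInMeasure_est (hk : 2 ≤ d.k) {β : ℝ} (hβ : 0 ≤ β) (hθ₀ : θ₀ ∈ paramSpace)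
    {T : ℕ → Ω → ℝ} (hT : ∀ m, Measurable (T m)) (hindep : iIndepFun T P)
    (hlaw : ∀ m s, P.real {ω | T m ω ≤ s} = d.cdfT θ₀ s) {est : ℕ → Ω → Fin 2 → ℝ}
    (hmin : ∀ N, ∀ᵐ ω ∂P,
      (∃ θ, d.IsMDPDE β (d.empirical (fun m => T m ω) N) θ) →
        d.IsMDPDE β (d.empirical (fun m => T m ω) N) (est N ω))
    {h : (Fin 2 → ℝ) → ℝ} {g : Fin 2 → ℝ} (hh : HasFDerivAt h (dotCLM g) θ₀) :
    TendstoInMeasure P ((fun (N : ℕ) ω => √(N : ℝ) * (h (est N ω) - h θ₀)) -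
      fun (N : ℕ) ω => √(N : ℝ) * (d.influence β θ₀ g ⬝ᵥ
        (d.empirical (fun m => T m ω) N - d.cellProb θ₀))) atTop 0 := by
  rw [tendstoInMeasure_iff_norm]
  intro η hη
  rw [ENNReal.tendsto_nhds_zero]
  intro δ hδ
  -- `M` makes the tail of the rescaled deviation at most `δ`. The expansion is then used with
  -- constant `η / M`, so that off the tail event the rescaled remainder is below `η`; `M / ρ < √N`
  -- brings the frequencies within its radius `ρ`.
  obtain ⟨M, hM, hMδ⟩ : ∃ M : ℝ, 0 < M ∧ ENNReal.ofReal ((d.L + 1) / M ^ 2) ≤ δ := by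
    have : Tendsto (fun M : ℝ => ENNReal.ofReal ((d.L + 1) / M ^ 2)) atTop (𝓝 0) := by
      rw [← ENNReal.ofReal_zero]
      exact ENNReal.tendsto_ofReal (tendsto_const_nhds.div_atTop (tendsto_pow_atTop two_ne_zero))
    obtain ⟨M, h1, h2⟩ := ((eventually_gt_atTop (0 : ℝ)).and
      (ENNReal.tendsto_nhds_zero.1 this δ hδ)).exists
    exact ⟨M, h1, h2⟩
  obtain ⟨ρ, hρ, hball⟩ := Metric.eventually_nhds_iff.1
    (d.eventually_isMDPDE_expansion hk hβ hθ₀ hh (div_pos hη hM))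
  have hlarge : ∀ᶠ N : ℕ in atTop, M / ρ < √(N : ℝ) :=
    (Real.tendsto_sqrt_atTop.comp tendsto_natCast_atTop_atTop).eventually_gt_atTop _
  filter_upwards [hlarge, eventually_gt_atTop 0] with N hN hN0
  have hs : 0 < √(N : ℝ) := Real.sqrt_pos.2 (Nat.cast_pos.2 hN0)
  refine (measure_mono_ae ?_).trans
    ((d.measure_le_sqrt_mul_norm_empirical hT hindep hlaw hN0 hM).trans hMδ)
  filter_upwards [hmin N] with ω hω hle
  change M ≤ √(N : ℝ) * ‖d.empirical (fun m => T m ω) N - d.cellProb θ₀‖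
  by_contra! hcon
  have hdist : dist (d.empirical (fun m => T m ω) N) (d.cellProb θ₀) < ρ := by
    rw [dist_eq_norm]
    rw [div_lt_iff₀ hρ] at hN
    exact lt_of_mul_lt_mul_left (hcon.trans hN) hs.le
  obtain ⟨hex, hall⟩ := hball hdist
  have hb := hall _ (hω hex)
  rw [influence_dotProduct] at hb
  refine absurd (show η ≤ _ from hle) (not_le.2 ?_)
  simp only [Pi.sub_apply, Pi.zero_apply, sub_zero, ← mul_sub]
  rw [norm_mul, Real.norm_eq_abs, Real.norm_eq_abs, abs_of_pos hs]
  calc _ ≤ √(N : ℝ) * (η / M * ‖d.empirical (fun m => T m ω) N - d.cellProb θ₀‖) :=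
        mul_le_mul_of_nonneg_left hb hs.le
    _ = η / M * (√(N : ℝ) * ‖d.empirical (fun m => T m ω) N - d.cellProb θ₀‖) := by ring
    _ < η / M * M := mul_lt_mul_of_pos_left hcon (div_pos hη hM)
    _ = η := div_mul_cancel₀ _ hM.ne'

end Sample

end StepStressPlan

end

/-! ### Asymptotic normality of the estimated reliability. -/

theorem theorem7
    (d : StepStressPlan) (hk : 2 ≤ d.k)
    (β : ℝ) (hβ : 0 ≤ β)
    -- the true parameter
    (θ₀ : Fin 2 → ℝ) (hθ₀ : θ₀ ∈ StepStressPlan.paramSpace)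
    -- independent lifetimes of the devices, with distribution function `G_T` at `θ₀`
    {Ω : Type*} [MeasurableSpace Ω] (P : Measure Ω) [IsProbabilityMeasure P]
    (T : ℕ → Ω → ℝ) (hT : ∀ m, Measurable (T m)) (hindep : iIndepFun T P)
    (hlaw : ∀ m s, P.real {ω | T m ω ≤ s} = d.cdfT θ₀ s)
    -- the estimator: a minimizer of the divergence whenever the data admit one
    (est : ℕ → Ω → Fin 2 → ℝ) (hest : ∀ N, AEMeasurable (est N) P)
    (hmin : ∀ N, ∀ᵐ ω ∂P,
      (∃ θ, d.IsMDPDE β (d.empirical (fun m => T m ω) N) θ) →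
        d.IsMDPDE β (d.empirical (fun m => T m ω) N) (est N ω))
    (x₀ t : ℝ) (ht : 0 ≤ t) :
    -- the explicit vector is the gradient of the reliability
    (∀ θ : EuclideanSpace ℝ (Fin 2), θ.ofLp ∈ StepStressPlan.paramSpace →
      HasGradientAt (fun θ' : EuclideanSpace ℝ (Fin 2) =>
          StepStressPlan.reliability x₀ t θ'.ofLp)
        (WithLp.toLp 2 (StepStressPlan.reliabilityGrad x₀ t θ.ofLp)) θ) ∧
    -- the asymptotic variance is well defined
    IsUnit (d.J β θ₀).det ∧
    0 ≤ d.reliabilityVar β x₀ t θ₀ ∧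
    -- asymptotic normality
    TendstoInDistribution
      (fun (N : ℕ) ω => Real.sqrt N *
        (StepStressPlan.reliability x₀ t (est N ω) - StepStressPlan.reliability x₀ t θ₀))
      atTop (id : ℝ → ℝ) (fun _ => P)
      (gaussianReal 0 (d.reliabilityVar β x₀ t θ₀).toNNReal) := by
  have hvar := d.reliabilityVar_eq β x₀ t hθ₀
  refine ⟨fun θ hθ => StepStressPlan.hasGradientAt_reliability x₀ t hθ,
    d.isUnit_det_J hk β hθ₀, ?_, ?_⟩
  -- Nonnegativity comes from recognizing the number as the variance of a step function of one
  -- lifetime.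
  · rw [hvar, ← d.variance_cellFun (hT 0) (hlaw 0)]
    exact variance_nonneg _ _
  · refine tendstoInDistribution_of_tendstoInMeasure_sub _ _
      (d.tendstoInDistribution_empirical hT hindep hlaw _ hvar)
      (d.tendstoInMeasure_est hk hβ hθ₀ hT hindep hlaw hmin
        (StepStressPlan.hasFDerivAt_reliability x₀ t hθ₀)) fun N => ?_
    have hc : Continuous (StepStressPlan.reliability x₀ t) := by
      unfold StepStressPlan.reliability
      fun_prop
    exact ((hc.measurable.comp_aemeasurable (hest N)).sub_const _).const_mul _
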